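/- Let $F$ be a field and let $\Lambda$ be a finite-dimensional hereditary $F$-algebra, i.e. every submodule of a projective left $\Lambda$-module is projective. Let $\Lambda\text{-mod}$ be the category of finitely generated left $\Lambda$-modules, write $(-)^*=\operatorname{Hom}_F(-,F)$, let $(-)^\vee=\operatorname{Hom}_\Lambda(-,\Lambda)$, and let $\nu=(-)^{\vee *}$ be the Nakayama functor, so that $\nu\Lambda\cong\Lambda^*$. Let $\tau=\operatorname{Ext}^1_\Lambda(-,\Lambda)^*$ and $\tau^-=\operatorname{Ext}^1_{\Lambda^{\mathrm{op}}}((-)^*,\Lambda)$ be the Auslander–Reiten translations, regarded as endofunctors of $\Lambda\text{-mod}$, and write $\tau^{-r}=(\tau^-)^r$ for $r\ge 0$. The preprojective algebra is $$\Pi=\bigoplus_{r\ge 0}\operatorname{Hom}_\Lambda(\Lambda,\tau^{-r}\Lambda),$$ where the product of $g:\Lambda\to\tau^{-s}\Lambda$ and $f:\Lambda\to\tau^{-r}\Lambda$ is $gf=\tau^{-r}g\circ f$. The postinjective algebra is $$\Pi'=\bigoplus_{r\ge 0}\operatorname{Hom}_\Lambda(\tau^{r}\Lambda^*,\Lambda^*),$$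 where the product of $g:\tau^s\Lambda^*\to\Lambda^*$ and $f:\tau^r\Lambda^*\to\Lambda^*$ is $gf=g\circ\tau^sf$. In both algebras the $r$-th summand is the part of degree $r$. Then $\tau^-$ is left adjoint to $\tau$. Fix any adjunction between them. For finitely generated projective left $\Lambda$-modules $P,Q$ and $r\ge0$ let $\Delta^r_{P,Q}$ be the composite of the isomorphisms $$\operatorname{Hom}_\Lambda(P,\tau^{-r}Q)\to\operatorname{Hom}_\Lambda(\tau^{-r}Q,\nu P)^*\to\operatorname{Hom}_\Lambda(Q,\tau^{r}\nu P)^*\to\operatorname{Hom}_\Lambda(\tau^{r}\nu P,\nu Q)^{**}\to\operatorname{Hom}_\Lambda(\tau^{r}\nu P,\nu Q)$$ given by Serre duality $\operatorname{Hom}_\Lambda(P,M)\cong\operatorname{Hom}_\Lambda(M,\nu P)^*$, the ($r$-fold iterated) adjunction, Serre duality again, and evaluation. Let $\Delta:\Pi\to\Pi'$ be the linear map which in degree $r$ is $\Delta^r_{\Lambda,\Lambda}$, where $\nu\Lambda$ is identified with $\Lambda^*$. Then $\Delta$ is an isomorphism of graded $F$-algebras. Moreover, $\Delta$ is given by the maps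 $\Delta^r_{P,Q}$ on components: for $P,Q$ as above, $f:P\to\tau^{-r}Q$, $a:\Lambda\to P$ and $b:Q\to\Lambda$, $$\Delta\bigl(\tau^{-r}(b)\circ f\circ a\bigr)=\nu(b)\circ\Delta^r_{P,Q}(f)\circ\tau^r(\nu(a)).$$ In particular, if $\Lambda=\bigoplus_i P_i$ is a decomposition of the regular left module and $I_i=\nu P_i$, then $\Delta$ sends $f:P_i\to\tau^{-r}P_j$ to $\Delta^r_{P_i,P_j}(f):\tau^rI_i\to I_j$. -/

import Mathlib

open CategoryTheory
open scoped TensorProduct DirectSum ModuleCat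

universe u v

namespace HereditaryAlgebra

noncomputable section

/-! ### Hereditary rings -/

/-- A ring is (left) hereditary if every submodule of a projective left module is projective. -/
def IsHereditary (A : Type u) [Ring A] : Prop :=
  ∀ (P : Type u) [AddCommGroup P] [Module A P], Module.Projective A P →
    ∀ N : Submodule A P, Module.Projective A N

/-! ### Iterates of an endofunctor and the two graded algebras attached to it -/

section Iterates

variable {C : Type u} [Category.{v} C]

/-- The iterate `L ^ n`, with `L ^ (n + 1) X = L (L ^ n X)`. -/
def iterL (L : C ⥤ C) : ℕ → (C ⥤ C)
  | 0 => 𝟭 C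
  | n + 1 => iterL L n ⋙ L

/-- The iterate `R ^ n`, with `R ^ (n + 1) X = R ^ n (R X)`. -/
def iterR (R : C ⥤ C) : ℕ → (C ⥤ C)
  | 0 => 𝟭 C
  | n + 1 => R ⋙ iterR R n

theorem iterL_comp (L : C ⥤ C) (s r : ℕ) : iterL L s ⋙ iterL L r = iterL L (s + r) := by
  induction r with
  | zero => rfl
  | succ r ih => exact congrArg (fun G => G ⋙ L) ih

theorem iterR_comp (R : C ⥤ C) (s r : ℕ) : iterR R r ⋙ iterR R s = iterR R (s + r) := by
  induction r with
  | zero => rfl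
  | succ r ih => exact congrArg (fun G => R ⋙ G) ih

theorem iterL_obj (L : C ⥤ C) (s r : ℕ) (X : C) :
    (iterL L r).obj ((iterL L s).obj X) = (iterL L (s + r)).obj X :=
  Functor.congr_obj (iterL_comp L s r) X

theorem iterR_obj (R : C ⥤ C) (s r : ℕ) (Y : C) :
    (iterR R s).obj ((iterR R r).obj Y) = (iterR R (s + r)).obj Y :=
  Functor.congr_obj (iterR_comp R s r) Y

/-- The iterate of an adjunction `L ⊣ R`. -/
def iterAdj {L R : C ⥤ C} (adj : L ⊣ R) : ∀ n : ℕ, iterL L n ⊣ iterR R n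
  | 0 => Adjunction.id
  | n + 1 => (iterAdj adj n).comp adj

section GradedPieces

variable (L R : C ⥤ C) (X Y : C)

/-- The degree `r` part `Hom (X, L ^ r X)`. -/
def LPiece (r : ℕ) : Type v := X ⟶ (iterL L r).obj X

/-- The degree `r` part `Hom (R ^ r Y, Y)`. -/
def RPiece (r : ℕ) : Type v := (iterR R r).obj Y ⟶ Y

variable {L R X Y}

/-- The product of `g : X ⟶ L ^ s X` and `f : X ⟶ L ^ r X` is `L ^ r g ∘ f`. -/
def LPiece.mul {s r : ℕ} (g : LPiece L X s) (f : LPiece L X r) : LPiece L X (s + r) :=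
  (show X ⟶ (iterL L r).obj X from f) ≫ (iterL L r).map g ≫ eqToHom (iterL_obj L s r X)

/-- The product of `g : R ^ s Y ⟶ Y` and `f : R ^ r Y ⟶ Y` is `g ∘ R ^ s f`. -/
def RPiece.mul {s r : ℕ} (g : RPiece R Y s) (f : RPiece R Y r) : RPiece R Y (s + r) :=
  eqToHom (iterR_obj R s r Y).symm ≫ (iterR R s).map f ≫ (show (iterR R s).obj Y ⟶ Y from g)

theorem LPiece.mk_eq {i j : ℕ} (h : i = j) (f : X ⟶ (iterL L i).obj X)
    (g : X ⟶ (iterL L j).obj X) (w : f ≫ eqToHom (by rw [h]) = g) :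
    (GradedMonoid.mk i f : GradedMonoid (LPiece L X)) = GradedMonoid.mk j g := by
  subst h; simp at w; rw [w]

theorem RPiece.mk_eq {i j : ℕ} (h : i = j) (f : (iterR R i).obj Y ⟶ Y)
    (g : (iterR R j).obj Y ⟶ Y) (w : eqToHom (by rw [h]) ≫ f = g) :
    (GradedMonoid.mk i f : GradedMonoid (RPiece R Y)) = GradedMonoid.mk j g := by
  subst h; simp at w; rw [w]

theorem LPiece.one_mul {r : ℕ} (f : X ⟶ (iterL L r).obj X) :
    (GradedMonoid.mk (0 + r) (LPiece.mul (s := 0) (𝟙 X) f) : GradedMonoid (LPiece L X)) =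
      GradedMonoid.mk r f := by
  refine LPiece.mk_eq (Nat.zero_add r) _ _ ?_
  have h : (iterL L r).map (𝟙 X) = 𝟙 _ := (iterL L r).map_id X
  change (f ≫ (iterL L r).map (𝟙 X) ≫ eqToHom _) ≫ eqToHom _ = f
  rw [h]
  simp

theorem LPiece.mul_one {r : ℕ} (f : X ⟶ (iterL L r).obj X) :
    (GradedMonoid.mk (r + 0) (LPiece.mul (r := 0) f (𝟙 X)) : GradedMonoid (LPiece L X)) =
      GradedMonoid.mk r f := by
  refine LPiece.mk_eq (Nat.add_zero r) _ _ ?_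
  change (𝟙 X ≫ f ≫ 𝟙 _) ≫ 𝟙 _ = f
  simp

theorem LPiece.mul_assoc {t s r : ℕ} (h : X ⟶ (iterL L t).obj X) (g : X ⟶ (iterL L s).obj X)
    (f : X ⟶ (iterL L r).obj X) :
    (GradedMonoid.mk (t + s + r) (LPiece.mul (LPiece.mul h g) f) : GradedMonoid (LPiece L X)) =
      GradedMonoid.mk (t + (s + r)) (LPiece.mul h (LPiece.mul g f)) := by
  refine LPiece.mk_eq (Nat.add_assoc t s r) _ _ ?_
  have e := Functor.congr_hom (iterL_comp L s r) h
  change (f ≫ (iterL L r).map (g ≫ (iterL L s).map h ≫ eqToHom _) ≫ eqToHom _) ≫ eqToHom _ =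
    (f ≫ (iterL L r).map g ≫ eqToHom _) ≫ (iterL L (s + r)).map h ≫ eqToHom _
  simp only [Functor.comp_map] at e
  simp [e, eqToHom_map]

theorem RPiece.one_mul {r : ℕ} (f : (iterR R r).obj Y ⟶ Y) :
    (GradedMonoid.mk (0 + r) (RPiece.mul (s := 0) (𝟙 Y) f) : GradedMonoid (RPiece R Y)) =
      GradedMonoid.mk r f := by
  refine RPiece.mk_eq (Nat.zero_add r) _ _ ?_
  change eqToHom _ ≫ eqToHom _ ≫ f ≫ 𝟙 Y = f
  rw [Category.comp_id]
  have aux : ∀ {A B : C} (p : A = B) (q : B = A) (k : A ⟶ Y),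
      eqToHom p ≫ eqToHom q ≫ k = k := by
    intro A B p q k; subst p; simp
  exact aux _ _ f

theorem RPiece.mul_one {r : ℕ} (f : (iterR R r).obj Y ⟶ Y) :
    (GradedMonoid.mk (r + 0) (RPiece.mul (r := 0) f (𝟙 Y)) : GradedMonoid (RPiece R Y)) =
      GradedMonoid.mk r f := by
  refine RPiece.mk_eq (Nat.add_zero r) _ _ ?_
  have h : (iterR R r).map (𝟙 Y) = 𝟙 _ := (iterR R r).map_id Y
  change eqToHom _ ≫ eqToHom _ ≫ (iterR R r).map (𝟙 Y) ≫ f = f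
  rw [h]
  simp

theorem RPiece.mul_assoc {t s r : ℕ} (h : (iterR R t).obj Y ⟶ Y) (g : (iterR R s).obj Y ⟶ Y)
    (f : (iterR R r).obj Y ⟶ Y) :
    (GradedMonoid.mk (t + s + r) (RPiece.mul (RPiece.mul h g) f) : GradedMonoid (RPiece R Y)) =
      GradedMonoid.mk (t + (s + r)) (RPiece.mul h (RPiece.mul g f)) := by
  refine RPiece.mk_eq (Nat.add_assoc t s r) _ _ ?_
  have e := Functor.congr_hom (iterR_comp R t s) f
  change eqToHom _ ≫ eqToHom _ ≫ (iterR R (t + s)).map f ≫ eqToHom _ ≫ (iterR R t).map g ≫ h =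
    eqToHom _ ≫ (iterR R t).map (eqToHom _ ≫ (iterR R s).map f ≫ g) ≫ h
  simp only [Functor.comp_map] at e
  simp [e, eqToHom_map]

instance : GradedMonoid.GMul (LPiece L X) := ⟨LPiece.mul⟩

instance : GradedMonoid.GOne (LPiece L X) := ⟨𝟙 X⟩

instance : GradedMonoid.GMonoid (LPiece L X) where
  one_mul a := LPiece.one_mul a.2
  mul_one a := LPiece.mul_one a.2
  mul_assoc a b c := LPiece.mul_assoc a.2 b.2 c.2

instance : GradedMonoid.GMul (RPiece R Y) := ⟨RPiece.mul⟩

instance : GradedMonoid.GOne (RPiece R Y) := ⟨𝟙 Y⟩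

instance : GradedMonoid.GMonoid (RPiece R Y) where
  one_mul a := RPiece.one_mul a.2
  mul_one a := RPiece.mul_one a.2
  mul_assoc a b c := RPiece.mul_assoc a.2 b.2 c.2

end GradedPieces

section Algebras

variable (F : Type*) [Field F] [Preadditive C] [Linear F C]
variable (L R : C ⥤ C) (X Y : C)

instance iterL_additive [L.Additive] : ∀ n, (iterL L n).Additive
  | 0 => inferInstanceAs (𝟭 C).Additive
  | n + 1 => by
    have := iterL_additive n
    exact inferInstanceAs (iterL L n ⋙ L).Additive

instance iterR_additive [R.Additive] : ∀ n, (iterR R n).Additive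
  | 0 => inferInstanceAs (𝟭 C).Additive
  | n + 1 => by
    have := iterR_additive n
    exact inferInstanceAs (R ⋙ iterR R n).Additive

instance iterL_linear [L.Linear F] : ∀ n, (iterL L n).Linear F
  | 0 => inferInstanceAs ((𝟭 C).Linear F)
  | n + 1 => by
    have := iterL_linear n
    exact inferInstanceAs ((iterL L n ⋙ L).Linear F)

instance iterR_linear [R.Linear F] : ∀ n, (iterR R n).Linear F
  | 0 => inferInstanceAs ((𝟭 C).Linear F)
  | n + 1 => by
    have := iterR_linear n
    exact inferInstanceAs ((R ⋙ iterR R n).Linear F)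

instance (r : ℕ) : AddCommGroup (LPiece L X r) :=
  inferInstanceAs (AddCommGroup (X ⟶ (iterL L r).obj X))

instance (r : ℕ) : Module F (LPiece L X r) :=
  inferInstanceAs (Module F (X ⟶ (iterL L r).obj X))

instance (r : ℕ) : AddCommGroup (RPiece R Y r) :=
  inferInstanceAs (AddCommGroup ((iterR R r).obj Y ⟶ Y))

instance (r : ℕ) : Module F (RPiece R Y r) :=
  inferInstanceAs (Module F ((iterR R r).obj Y ⟶ Y))

instance [L.Additive] : DirectSum.GSemiring (LPiece L X) where
  mul_zero {i j} a := by
    change (0 : X ⟶ _) ≫ _ ≫ _ = 0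
    exact Limits.zero_comp
  zero_mul {i j} b := by
    change (show X ⟶ (iterL L j).obj X from b) ≫ (iterL L j).map 0 ≫ _ = 0
    rw [Functor.map_zero, Limits.zero_comp, Limits.comp_zero]
  mul_add {i j} a b c := Preadditive.add_comp _ _ _ _ _ _
  add_mul {i j} a b c := by
    change (show X ⟶ (iterL L j).obj X from c) ≫
      (iterL L j).map ((show X ⟶ (iterL L i).obj X from a) +
        (show X ⟶ (iterL L i).obj X from b)) ≫ _ = _
    rw [Functor.map_add, Preadditive.add_comp, Preadditive.comp_add]
    rfl
  natCast n := n • (𝟙 X : X ⟶ X)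
  natCast_zero := zero_nsmul _
  natCast_succ n := succ_nsmul _ n

instance [R.Additive] : DirectSum.GSemiring (RPiece R Y) where
  mul_zero {i j} a := by
    change _ ≫ (iterR R i).map 0 ≫ (show (iterR R i).obj Y ⟶ Y from a) = 0
    rw [Functor.map_zero, Limits.zero_comp, Limits.comp_zero]
  zero_mul {i j} b := by
    change _ ≫ _ ≫ (0 : _ ⟶ Y) = 0
    rw [Limits.comp_zero, Limits.comp_zero]
  mul_add {i j} a b c := by
    change _ ≫ (iterR R i).map ((show (iterR R j).obj Y ⟶ Y from b) +
      (show (iterR R j).obj Y ⟶ Y from c)) ≫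
      (show (iterR R i).obj Y ⟶ Y from a) = _
    rw [Functor.map_add, Preadditive.add_comp, Preadditive.comp_add]
    rfl
  add_mul {i j} a b c := by
    change _ ≫ _ ≫ ((show (iterR R i).obj Y ⟶ Y from a) +
      (show (iterR R i).obj Y ⟶ Y from b)) = _
    rw [Preadditive.comp_add, Preadditive.comp_add]
    rfl
  natCast n := n • (𝟙 Y : Y ⟶ Y)
  natCast_zero := zero_nsmul _
  natCast_succ n := succ_nsmul _ n

theorem LPiece.smul_mul [L.Additive] [L.Linear F] {s r : ℕ} (c : F) (g : LPiece L X s)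
    (f : LPiece L X r) : LPiece.mul (c • g) f = c • LPiece.mul g f := by
  change (show X ⟶ (iterL L r).obj X from f) ≫
    (iterL L r).map (c • (show X ⟶ (iterL L s).obj X from g)) ≫ _ = _
  rw [Functor.map_smul, Linear.smul_comp, Linear.comp_smul]
  rfl

theorem LPiece.mul_smul [L.Additive] {s r : ℕ} (c : F) (g : LPiece L X s)
    (f : LPiece L X r) : LPiece.mul g (c • f) = c • LPiece.mul g f :=
  Linear.smul_comp _ _ _ _ _ _

theorem RPiece.smul_mul [R.Additive] {s r : ℕ} (c : F) (g : RPiece R Y s)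
    (f : RPiece R Y r) : RPiece.mul (c • g) f = c • RPiece.mul g f := by
  change _ ≫ _ ≫ (c • (show (iterR R s).obj Y ⟶ Y from g)) = _
  rw [Linear.comp_smul, Linear.comp_smul]
  rfl

theorem RPiece.mul_smul [R.Additive] [R.Linear F] {s r : ℕ} (c : F) (g : RPiece R Y s)
    (f : RPiece R Y r) : RPiece.mul g (c • f) = c • RPiece.mul g f := by
  change _ ≫ (iterR R s).map (c • (show (iterR R r).obj Y ⟶ Y from f)) ≫
    (show (iterR R s).obj Y ⟶ Y from g) = _
  rw [Functor.map_smul, Linear.smul_comp, Linear.comp_smul]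
  rfl

instance [L.Additive] [L.Linear F] : Algebra F (⨁ r, LPiece L X r) :=
  Algebra.ofModule
    (fun c x y => by
      induction x using DirectSum.induction_on with
      | zero => simp
      | add a b ha hb => rw [smul_add, add_mul, ha, hb, add_mul, smul_add]
      | of i a =>
        induction y using DirectSum.induction_on with
        | zero => simp
        | add a b ha hb => rw [mul_add, ha, hb, mul_add, smul_add]
        | of j b =>
          rw [← DirectSum.of_smul, DirectSum.of_mul_of, DirectSum.of_mul_of, ← DirectSum.of_smul]
          exact congrArg _ (LPiece.smul_mul F L X c a b))
    (fun c x y => by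
      induction x using DirectSum.induction_on with
      | zero => simp
      | add a b ha hb => rw [add_mul, ha, hb, add_mul, smul_add]
      | of i a =>
        induction y using DirectSum.induction_on with
        | zero => simp
        | add a b ha hb => rw [smul_add, mul_add, ha, hb, mul_add, smul_add]
        | of j b =>
          rw [← DirectSum.of_smul, DirectSum.of_mul_of, DirectSum.of_mul_of, ← DirectSum.of_smul]
          exact congrArg _ (LPiece.mul_smul F L X c a b))

instance [R.Additive] [R.Linear F] : Algebra F (⨁ r, RPiece R Y r) :=
  Algebra.ofModule
    (fun c x y => by
      induction x using DirectSum.induction_on with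
      | zero => simp
      | add a b ha hb => rw [smul_add, add_mul, ha, hb, add_mul, smul_add]
      | of i a =>
        induction y using DirectSum.induction_on with
        | zero => simp
        | add a b ha hb => rw [mul_add, ha, hb, mul_add, smul_add]
        | of j b =>
          rw [← DirectSum.of_smul, DirectSum.of_mul_of, DirectSum.of_mul_of, ← DirectSum.of_smul]
          exact congrArg _ (RPiece.smul_mul F R Y c a b))
    (fun c x y => by
      induction x using DirectSum.induction_on with
      | zero => simp
      | add a b ha hb => rw [add_mul, ha, hb, add_mul, smul_add]
      | of i a =>
        induction y using DirectSum.induction_on with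
        | zero => simp
        | add a b ha hb => rw [smul_add, mul_add, ha, hb, mul_add, smul_add]
        | of j b =>
          rw [← DirectSum.of_smul, DirectSum.of_mul_of, DirectSum.of_mul_of, ← DirectSum.of_smul]
          exact congrArg _ (RPiece.mul_smul F R Y c a b))

/-- The bijection `Hom (L ^ n X, Y) ≃ Hom (X, R ^ n Y)` given by an adjunction `L ⊣ R`. -/
def iterHomEquiv {L R : C ⥤ C} (adj : L ⊣ R) [R.Additive] [R.Linear F] (n : ℕ) (X Y : C) :
    ((iterL L n).obj X ⟶ Y) ≃ₗ[F] (X ⟶ (iterR R n).obj Y) where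
  toFun := (iterAdj adj n).homEquiv X Y
  invFun := ((iterAdj adj n).homEquiv X Y).symm
  left_inv := ((iterAdj adj n).homEquiv X Y).left_inv
  right_inv := ((iterAdj adj n).homEquiv X Y).right_inv
  map_add' f g := by simp [Adjunction.homEquiv_unit]
  map_smul' c f := by simp [Adjunction.homEquiv_unit]

end Algebras

end Iterates

/-! ### Duals of modules -/

section Duals

variable (F : Type u) [Field F]

/-- The dual `M^*` of a left `A`-module, as a right `A`-module: `(ξ a) x = ξ (a x)`. -/
def DualL (M : Type u) [AddCommGroup M] [Module F M] : Type u := M →ₗ[F] F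

/-- The dual `X^*` of a right `A`-module, as a left `A`-module: `(a ξ) x = ξ (x a)`. -/
def DualR (X : Type u) [AddCommGroup X] [Module F X] : Type u := X →ₗ[F] F

section

variable (M : Type u) [AddCommGroup M] [Module F M]

instance : AddCommGroup (DualL F M) := inferInstanceAs (AddCommGroup (M →ₗ[F] F))
instance : Module F (DualL F M) := inferInstanceAs (Module F (M →ₗ[F] F))
instance : FunLike (DualL F M) M F := inferInstanceAs (FunLike (M →ₗ[F] F) M F)
instance : AddCommGroup (DualR F M) := inferInstanceAs (AddCommGroup (M →ₗ[F] F))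
instance : Module F (DualR F M) := inferInstanceAs (Module F (M →ₗ[F] F))
instance : FunLike (DualR F M) M F := inferInstanceAs (FunLike (M →ₗ[F] F) M F)
instance : LinearMapClass (DualL F M) F M F :=
  inferInstanceAs (LinearMapClass (M →ₗ[F] F) F M F)
instance : LinearMapClass (DualR F M) F M F :=
  inferInstanceAs (LinearMapClass (M →ₗ[F] F) F M F)
instance [Module.Finite F M] : Module.Finite F (DualL F M) :=
  inferInstanceAs (Module.Finite F (M →ₗ[F] F))
instance [Module.Finite F M] : Module.Finite F (DualR F M) :=
  inferInstanceAs (Module.Finite F (M →ₗ[F] F))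

@[ext] theorem DualL.ext {M : Type u} [AddCommGroup M] [Module F M] {ξ η : DualL F M}
    (h : ∀ x, ξ x = η x) : ξ = η := LinearMap.ext h

@[ext] theorem DualR.ext {M : Type u} [AddCommGroup M] [Module F M] {ξ η : DualR F M}
    (h : ∀ x, ξ x = η x) : ξ = η := LinearMap.ext h

end

variable {A : Type u} [Ring A] [Algebra F A]

instance (M : Type u) [AddCommGroup M] [Module F M] [Module A M] [IsScalarTower F A M] :
    Module Aᵐᵒᵖ (DualL F M) where
  smul a ξ := LinearMap.comp (show M →ₗ[F] F from ξ) (Algebra.lsmul F F M a.unop)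
  one_smul ξ := DualL.ext F fun x => congrArg ξ (one_smul A x)
  mul_smul a b ξ := DualL.ext F fun x => congrArg ξ (mul_smul b.unop a.unop x)
  smul_zero _ := rfl
  smul_add _ _ _ := rfl
  add_smul a b ξ := DualL.ext F fun x =>
    (congrArg ξ (add_smul a.unop b.unop x)).trans (map_add ξ _ _)
  zero_smul ξ := DualL.ext F fun x => (congrArg ξ (zero_smul A x)).trans (map_zero ξ)

instance (X : Type u) [AddCommGroup X] [Module F X] [Module Aᵐᵒᵖ X] [IsScalarTower F Aᵐᵒᵖ X] :
    Module A (DualR F X) where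
  smul a ξ := LinearMap.comp (show X →ₗ[F] F from ξ)
    (Algebra.lsmul F F X (MulOpposite.op a))
  one_smul ξ := DualR.ext F fun x => congrArg ξ (one_smul Aᵐᵒᵖ x)
  mul_smul a b ξ := DualR.ext F fun x =>
    congrArg ξ (mul_smul (MulOpposite.op b) (MulOpposite.op a) x)
  smul_zero _ := rfl
  smul_add _ _ _ := rfl
  add_smul a b ξ := DualR.ext F fun x =>
    (congrArg ξ (add_smul (MulOpposite.op a) (MulOpposite.op b) x)).trans (map_add ξ _ _)
  zero_smul ξ := DualR.ext F fun x => (congrArg ξ (zero_smul Aᵐᵒᵖ x)).trans (map_zero ξ)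

theorem DualL.smul_apply (M : Type u) [AddCommGroup M] [Module F M] [Module A M]
    [IsScalarTower F A M] (a : A) (ξ : DualL F M) (x : M) :
    (MulOpposite.op a • ξ) x = ξ (a • x) := rfl

theorem DualR.smul_apply (X : Type u) [AddCommGroup X] [Module F X] [Module Aᵐᵒᵖ X]
    [IsScalarTower F Aᵐᵒᵖ X] (a : A) (ξ : DualR F X) (x : X) :
    (a • ξ) x = ξ (MulOpposite.op a • x) := rfl

instance (M : Type u) [AddCommGroup M] [Module F M] [Module A M] [IsScalarTower F A M] :
    IsScalarTower F Aᵐᵒᵖ (DualL F M) :=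
  IsScalarTower.of_algebraMap_smul fun c ξ => DualL.ext F fun x =>
    (congrArg ξ (algebraMap_smul A c x)).trans (map_smul ξ c x)

instance (X : Type u) [AddCommGroup X] [Module F X] [Module Aᵐᵒᵖ X] [IsScalarTower F Aᵐᵒᵖ X] :
    IsScalarTower F A (DualR F X) :=
  IsScalarTower.of_algebraMap_smul fun c ξ => DualR.ext F fun x =>
    (congrArg ξ (algebraMap_smul Aᵐᵒᵖ c x)).trans (map_smul ξ c x)

/-- The transpose `f^* : N^* → M^*` of a map of left modules. -/
def DualL.map {M N : Type u} [AddCommGroup M] [Module F M] [Module A M] [IsScalarTower F A M]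
    [AddCommGroup N] [Module F N] [Module A N] [IsScalarTower F A N] (f : M →ₗ[A] N) :
    DualL F N →ₗ[Aᵐᵒᵖ] DualL F M where
  toFun ξ := LinearMap.comp (show N →ₗ[F] F from ξ) (f.restrictScalars F)
  map_add' _ _ := rfl
  map_smul' a ξ := DualL.ext F fun x => congrArg ξ (f.map_smul a.unop x).symm

/-- The transpose `f^* : Y^* → X^*` of a map of right modules. -/
def DualR.map {X Y : Type u} [AddCommGroup X] [Module F X] [Module Aᵐᵒᵖ X]
    [IsScalarTower F Aᵐᵒᵖ X] [AddCommGroup Y] [Module F Y] [Module Aᵐᵒᵖ Y]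
    [IsScalarTower F Aᵐᵒᵖ Y] (f : X →ₗ[Aᵐᵒᵖ] Y) :
    DualR F Y →ₗ[A] DualR F X where
  toFun ξ := LinearMap.comp (show Y →ₗ[F] F from ξ) (f.restrictScalars F)
  map_add' _ _ := rfl
  map_smul' a ξ := DualR.ext F fun x => congrArg ξ (f.map_smul (MulOpposite.op a) x).symm

end Duals

/-! ### `Ext¹` through the standard resolution -/

section ExtOne

variable (F : Type u) [Field F] (A : Type u) [Ring A] [Algebra F A]

/-- The free cover `A ⊗ M → M`, `a ⊗ m ↦ a m`. -/
def cover (M : Type u) [AddCommGroup M] [Module F M] [Module A M] [IsScalarTower F A M] :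
    A ⊗[F] M →ₗ[A] M :=
  TensorProduct.AlgebraTensorModule.lift
    { toFun := fun a =>
        { toFun := fun m => a • m
          map_add' := smul_add a
          map_smul' := fun c m => smul_comm a c m }
      map_add' := fun a b => LinearMap.ext fun m => add_smul a b m
      map_smul' := fun a b => LinearMap.ext fun m => mul_smul a b m }

/-- The kernel of the free cover `A ⊗ M → M`.  If `A` is hereditary it is projective, and
`0 → Syz M → A ⊗ M → M → 0` is a projective resolution of `M`, functorial in `M`. -/
abbrev Syz (M : Type u) [AddCommGroup M] [Module F M] [Module A M] [IsScalarTower F A M] :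
    Submodule A (A ⊗[F] M) :=
  LinearMap.ker (cover F A M)

variable {A}

/-- The map induced on the kernels of the free covers. -/
def Syz.map {M N : Type u} [AddCommGroup M] [Module F M] [Module A M] [IsScalarTower F A M]
    [AddCommGroup N] [Module F N] [Module A N] [IsScalarTower F A N] (f : M →ₗ[A] N) :
    Syz F A M →ₗ[A] Syz F A N :=
  (TensorProduct.AlgebraTensorModule.lTensor A A (f.restrictScalars F)).restrict (by
    intro x hx
    have h : (cover F A N) ∘ₗ
        TensorProduct.AlgebraTensorModule.lTensor A A (f.restrictScalars F) =
        f ∘ₗ cover F A M := by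
      ext m
      simp [cover]
    have h' := LinearMap.congr_fun h x
    rw [LinearMap.mem_ker] at hx ⊢
    simpa [hx] using h')

/-- Precomposition with a map of `A`-modules, linear over any ring `B` acting on the target. -/
def precomp (B : Type u) [Ring B] {M N W : Type u} [AddCommMonoid M] [Module A M]
    [AddCommMonoid N] [Module A N] [AddCommGroup W] [Module A W] [Module B W]
    [SMulCommClass A B W] (f : M →ₗ[A] N) : (N →ₗ[A] W) →ₗ[B] (M →ₗ[A] W) where
  toFun φ := φ.comp f
  map_add' _ _ := rfl
  map_smul' _ _ := rfl

variable (A) (B : Type u) [Ring B] [Algebra F B]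

/-- `Ext¹_A (M, W)` for a left `A`-module `M` and an `A`-module `W` with a commuting action
of `B`: the cokernel of `Hom_A (A ⊗ M, W) → Hom_A (Syz M, W)`. -/
abbrev ExtOne (M W : Type u) [AddCommGroup M] [Module F M] [Module A M] [IsScalarTower F A M]
    [AddCommGroup W] [Module A W] [Module B W] [SMulCommClass A B W] : Type u :=
  (Syz F A M →ₗ[A] W) ⧸ LinearMap.range (precomp B (W := W) (Syz F A M).subtype)

variable {A}

/-- The contravariant functoriality of `Ext¹_A (-, W)`. -/
def ExtOne.map {M N : Type u} (W : Type u) [AddCommGroup M] [Module F M] [Module A M]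
    [IsScalarTower F A M] [AddCommGroup N] [Module F N] [Module A N] [IsScalarTower F A N]
    [AddCommGroup W] [Module A W] [Module B W] [SMulCommClass A B W] (f : M →ₗ[A] N) :
    ExtOne F A B N W →ₗ[B] ExtOne F A B M W :=
  Submodule.mapQ _ _ (precomp B (Syz.map F f)) (by
    rintro _ ⟨φ, rfl⟩
    exact ⟨φ.comp (TensorProduct.AlgebraTensorModule.lTensor A A (f.restrictScalars F)), rfl⟩)

section MapLemmas

variable {M N K : Type u} [AddCommGroup M] [Module F M] [Module A M] [IsScalarTower F A M]
  [AddCommGroup N] [Module F N] [Module A N] [IsScalarTower F A N]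
  [AddCommGroup K] [Module F K] [Module A K] [IsScalarTower F A K]

theorem Syz.map_coe (f : M →ₗ[A] N) (x : Syz F A M) :
    (Syz.map F f x : A ⊗[F] N) = LinearMap.lTensor A (f.restrictScalars F) (x : A ⊗[F] M) := rfl

theorem Syz.map_id : Syz.map F (LinearMap.id : M →ₗ[A] M) = LinearMap.id :=
  LinearMap.ext fun x => Subtype.ext <|
    LinearMap.congr_fun (LinearMap.lTensor_id A M : LinearMap.lTensor A (.id : M →ₗ[F] M) = _) x.1

theorem Syz.map_comp (g : N →ₗ[A] K) (f : M →ₗ[A] N) :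
    Syz.map F (g.comp f) = (Syz.map F g).comp (Syz.map F f) :=
  LinearMap.ext fun x => Subtype.ext <| LinearMap.congr_fun
    (LinearMap.lTensor_comp A (g.restrictScalars F) (f.restrictScalars F)) x.1

theorem Syz.map_add (f g : M →ₗ[A] N) : Syz.map F (f + g) = Syz.map F f + Syz.map F g :=
  LinearMap.ext fun x => Subtype.ext <| LinearMap.congr_fun
    (LinearMap.lTensor_add A (f.restrictScalars F) (g.restrictScalars F)) x.1

theorem Syz.map_smul (c : F) (f : M →ₗ[A] N) : Syz.map F (c • f) = c • Syz.map F f :=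
  LinearMap.ext fun x => Subtype.ext <| LinearMap.congr_fun
    (LinearMap.lTensor_smul A c (f.restrictScalars F)) x.1

variable (W : Type u) [AddCommGroup W] [Module A W] [Module B W] [SMulCommClass A B W]

set_option linter.unusedSectionVars false in
theorem ExtOne.map_mk (f : M →ₗ[A] N) (φ : Syz F A N →ₗ[A] W) :
    ExtOne.map F B W f (Submodule.Quotient.mk φ) =
      Submodule.Quotient.mk (φ.comp (Syz.map F f)) := rfl

theorem ExtOne.map_id : ExtOne.map F B W (LinearMap.id : M →ₗ[A] M) = LinearMap.id := by
  refine LinearMap.ext fun x => ?_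
  obtain ⟨φ, rfl⟩ := Submodule.Quotient.mk_surjective _ x
  rw [ExtOne.map_mk, Syz.map_id]
  rfl

theorem ExtOne.map_comp (g : N →ₗ[A] K) (f : M →ₗ[A] N) :
    ExtOne.map F B W (g.comp f) = (ExtOne.map F B W f).comp (ExtOne.map F B W g) := by
  refine LinearMap.ext fun x => ?_
  obtain ⟨φ, rfl⟩ := Submodule.Quotient.mk_surjective _ x
  rw [ExtOne.map_mk, Syz.map_comp]
  rfl

theorem ExtOne.map_add (f g : M →ₗ[A] N) :
    ExtOne.map F B W (f + g) = ExtOne.map F B W f + ExtOne.map F B W g := by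
  refine LinearMap.ext fun x => ?_
  obtain ⟨φ, rfl⟩ := Submodule.Quotient.mk_surjective _ x
  rw [ExtOne.map_mk, Syz.map_add, LinearMap.comp_add]
  rfl

theorem ExtOne.map_smul [Module F W] [IsScalarTower F A W] [IsScalarTower F B W] (c : F)
    (f : M →ₗ[A] N) : ExtOne.map F B W (c • f) = c • ExtOne.map F B W f := by
  refine LinearMap.ext fun x => ?_
  obtain ⟨φ, rfl⟩ := Submodule.Quotient.mk_surjective _ x
  rw [ExtOne.map_mk, Syz.map_smul]
  have h : φ.comp (c • Syz.map F f) = c • φ.comp (Syz.map F f) := by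
    refine LinearMap.ext fun y => ?_
    exact φ.map_smul_of_tower c _
  rw [h]
  rfl

end MapLemmas

end ExtOne

/-! ### Finiteness -/

section Finiteness

variable (F : Type u) [Field F] {A : Type u} [Ring A] [Algebra F A]

theorem finite_hom (M W : Type u) [AddCommGroup M] [Module F M] [Module A M]
    [IsScalarTower F A M] [AddCommGroup W] [Module F W] [Module A W] [IsScalarTower F A W]
    [Module.Finite F M] [Module.Finite F W] : Module.Finite F (M →ₗ[A] W) :=
  Module.Finite.of_injective (LinearMap.restrictScalarsₗ F A M W F)
    (LinearMap.restrictScalars_injective F)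

theorem finite_syz [Module.Finite F A] (M : Type u) [AddCommGroup M] [Module F M] [Module A M]
    [IsScalarTower F A M] [Module.Finite F M] : Module.Finite F (Syz F A M) :=
  Module.Finite.of_injective ((Syz F A M).subtype.restrictScalars F)
    (Submodule.subtype_injective _)

instance [Module.Finite F A] (M : FGModuleCat.{u} A) : Module.Finite F M :=
  Module.Finite.trans A M

end Finiteness

/-! ### The functors -/

section Functors

variable (F : Type u) [Field F] (A : Type u) [Ring A] [Algebra F A] [Module.Finite F A]

instance finite_nu (P : Type u) [AddCommGroup P] [Module F P] [Module A P] [IsScalarTower F A P]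
    [Module.Finite F P] : Module.Finite A (DualR F (P →ₗ[A] A)) :=
  have : Module.Finite F (P →ₗ[A] A) := finite_hom F P A
  Module.Finite.of_restrictScalars_finite F A _

instance finite_tau (M : Type u) [AddCommGroup M] [Module F M] [Module A M] [IsScalarTower F A M]
    [Module.Finite F M] : Module.Finite A (DualR F (ExtOne F A Aᵐᵒᵖ M A)) :=
  have := finite_syz F (A := A) M
  have : Module.Finite F (Syz F A M →ₗ[A] A) := finite_hom F (A := A) (Syz F A M) A
  Module.Finite.of_restrictScalars_finite F A _

instance finite_tauInv (M : Type u) [AddCommGroup M] [Module F M] [Module A M]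
    [IsScalarTower F A M] [Module.Finite F M] :
    Module.Finite A (ExtOne F Aᵐᵒᵖ A (DualL F M) A) :=
  have := finite_syz F (A := Aᵐᵒᵖ) (DualL F M)
  have : Module.Finite F (Syz F Aᵐᵒᵖ (DualL F M) →ₗ[Aᵐᵒᵖ] A) :=
    finite_hom F (A := Aᵐᵒᵖ) (Syz F Aᵐᵒᵖ (DualL F M)) A
  Module.Finite.of_restrictScalars_finite F A _

/-- The Nakayama functor `ν = (-)^{∨*}`, with `P^∨ = Hom_A (P, A)`. -/
def nu : FGModuleCat.{u} A ⥤ FGModuleCat.{u} A where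
  obj P := FGModuleCat.of A (DualR F (P →ₗ[A] A))
  map f := FGModuleCat.ofHom (DualR.map F (precomp Aᵐᵒᵖ f.hom.hom))
  map_id _ := rfl
  map_comp _ _ := rfl

/-- The Auslander-Reiten translation `τ = D Tr` of a hereditary algebra, as an endofunctor of the
category of finitely generated left modules.  For a hereditary algebra the transpose
is `Tr = Ext¹_A (-, A)`, from left to right modules. -/
def tau : FGModuleCat.{u} A ⥤ FGModuleCat.{u} A where
  obj M := FGModuleCat.of A (DualR F (ExtOne F A Aᵐᵒᵖ M A))
  map f := FGModuleCat.ofHom (DualR.map F (ExtOne.map F Aᵐᵒᵖ A f.hom.hom))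
  map_id _ := by
    refine FGModuleCat.hom_ext ?_
    change DualR.map F (ExtOne.map F Aᵐᵒᵖ A LinearMap.id) = LinearMap.id
    rw [ExtOne.map_id]
    rfl
  map_comp f g := by
    refine FGModuleCat.hom_ext ?_
    change DualR.map F (ExtOne.map F Aᵐᵒᵖ A (g.hom.hom.comp f.hom.hom)) = _
    rw [ExtOne.map_comp]
    rfl

/-- The inverse Auslander-Reiten translation `τ⁻ = Tr D` of a hereditary algebra, as an
endofunctor of the category of finitely generated left modules.  Here `Tr = Ext¹ (-, A)` goes from
right modules, that is, modules over the opposite algebra, to left modules. -/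
def tauInv : FGModuleCat.{u} A ⥤ FGModuleCat.{u} A where
  obj M := FGModuleCat.of A (ExtOne F Aᵐᵒᵖ A (DualL F M) A)
  map f := FGModuleCat.ofHom (ExtOne.map F A A (DualL.map F f.hom.hom))
  map_id _ := FGModuleCat.hom_ext (ExtOne.map_id F A A)
  map_comp f g := FGModuleCat.hom_ext
    (ExtOne.map_comp F A A (DualL.map F f.hom.hom) (DualL.map F g.hom.hom))

instance : (tau F A).Additive where
  map_add {_ _ f g} := by
    refine FGModuleCat.hom_ext ?_
    change DualR.map F (ExtOne.map F Aᵐᵒᵖ A (f.hom.hom + g.hom.hom)) = _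
    rw [ExtOne.map_add]
    refine LinearMap.ext fun ξ => DualR.ext F fun x => ?_
    exact map_add ξ _ _

instance : (tau F A).Linear F where
  map_smul {M N} f c := by
    refine FGModuleCat.hom_ext ?_
    change DualR.map F (ExtOne.map F Aᵐᵒᵖ A (c • f.hom.hom)) = _
    rw [ExtOne.map_smul]
    refine LinearMap.ext fun ξ => ?_
    refine Eq.trans ?_ (algebraMap_smul A c (DualR.map F (ExtOne.map F Aᵐᵒᵖ A f.hom.hom) ξ)).symm
    refine DualR.ext F fun x => ?_
    exact map_smul ξ c _

instance : (tauInv F A).Additive where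
  map_add {_ _ f g} := by
    refine FGModuleCat.hom_ext ?_
    have h : DualL.map F (f.hom.hom + g.hom.hom) =
        DualL.map F f.hom.hom + DualL.map F g.hom.hom :=
      LinearMap.ext fun ξ => DualL.ext F fun x => map_add ξ _ _
    change ExtOne.map F A A (DualL.map F (f.hom.hom + g.hom.hom)) = _
    rw [h, ExtOne.map_add]
    rfl

instance : (tauInv F A).Linear F where
  map_smul {M N} f c := by
    refine FGModuleCat.hom_ext ?_
    have h : DualL.map F (c • f.hom.hom) = c • DualL.map F f.hom.hom :=
      LinearMap.ext fun ξ => DualL.ext F fun x => map_smul ξ c _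
    change ExtOne.map F A A (DualL.map F (c • f.hom.hom)) = _
    rw [h, ExtOne.map_smul]
    refine LinearMap.ext fun x => ?_
    exact (algebraMap_smul A c (ExtOne.map F A A (DualL.map F f.hom.hom) x)).symm

end Functors

/-! ### Serre duality -/

section Serre

variable (F : Type u) [Field F] {A : Type u} [Ring A] [Algebra F A] [Module.Finite F A]

instance (M N : FGModuleCat.{u} A) : Module.Finite F (M ⟶ N) := by
  have := finite_hom F (A := A) M N
  let f : (M ⟶ N) →ₗ[F] (M →ₗ[A] N) :=
    { toFun := fun f => f.hom.hom
      map_add' := fun _ _ => rfl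
      map_smul' := fun _ _ => rfl }
  exact Module.Finite.of_injective f fun a b h => FGModuleCat.hom_ext h

variable (P M : FGModuleCat.{u} A)

/-- For `φ ∈ P^∨` and `m ∈ M` the map `P → M`, `p ↦ φ p • m`. -/
def rankOne {P M : FGModuleCat.{u} A} (φ : P →ₗ[A] A) (m : M) : P ⟶ M :=
  FGModuleCat.ofHom ((LinearMap.toSpanSingleton A M m).comp φ)

theorem rankOne_apply {P M : FGModuleCat.{u} A} (φ : P →ₗ[A] A) (m : M) (p : P) :
    (rankOne φ m).hom.hom p = φ p • m := rfl

section RankOne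

variable {P M : FGModuleCat.{u} A}

theorem rankOne_add_left (φ ψ : P →ₗ[A] A) (m : M) :
    rankOne (φ + ψ) m = rankOne φ m + rankOne ψ m :=
  FGModuleCat.hom_ext (LinearMap.ext fun p => add_smul (φ p) (ψ p) m)

set_option linter.unusedSectionVars false in
theorem rankOne_smul_left (c : F) (φ : P →ₗ[A] A) (m : M) :
    rankOne (c • φ) m = c • rankOne φ m :=
  FGModuleCat.hom_ext (LinearMap.ext fun p => smul_assoc c (φ p) m)

theorem rankOne_add_right (φ : P →ₗ[A] A) (m n : M) :
    rankOne φ (m + n) = rankOne φ m + rankOne φ n :=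
  FGModuleCat.hom_ext (LinearMap.ext fun p => smul_add (φ p) m n)

theorem rankOne_op_smul (a : A) (φ : P →ₗ[A] A) (m : M) :
    rankOne (MulOpposite.op a • φ) m = rankOne φ (a • m) :=
  FGModuleCat.hom_ext (LinearMap.ext fun p => mul_smul (φ p) a m)

end RankOne

/-- The map `Hom (P, M)^* → Hom (M, ν P)` sending `ξ` to `m ↦ (φ ↦ ξ (p ↦ φ p • m))`. -/
def serreAux : Module.Dual F (P ⟶ M) →ₗ[F] (M ⟶ (nu F A).obj P) where
  toFun ξ := FGModuleCat.ofHom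
    { toFun := fun m =>
        ({ toFun := fun φ => ξ (rankOne φ m)
           map_add' := fun φ ψ => (congrArg ξ (rankOne_add_left φ ψ m)).trans (map_add ξ _ _)
           map_smul' := fun c φ =>
            (congrArg ξ (rankOne_smul_left F c φ m)).trans (map_smul ξ c _) } :
          (P →ₗ[A] A) →ₗ[F] F)
      map_add' := fun m n => LinearMap.ext fun φ =>
        (congrArg ξ (rankOne_add_right φ m n)).trans (map_add ξ _ _)
      map_smul' := fun a m => LinearMap.ext fun φ =>
        congrArg ξ (rankOne_op_smul a φ m).symm }
  map_add' _ _ := rfl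
  map_smul' c ξ := by
    refine FGModuleCat.hom_ext (LinearMap.ext fun m => ?_)
    refine Eq.trans ?_ (algebraMap_smul A c (M := DualR F (P →ₗ[A] A)) _).symm
    rfl

theorem serreAux_apply (ξ : Module.Dual F (P ⟶ M)) (m : M) (φ : P →ₗ[A] A) :
    (show DualR F (P →ₗ[A] A) from (serreAux F P M ξ).hom.hom m) φ = ξ (rankOne φ m) := rfl

theorem exists_dual_basis [Module.Projective A P] :
    ∃ (n : ℕ) (c : Fin n → (P →ₗ[A] A)) (b : Fin n → P), ∀ x, ∑ k, c k x • b k = x := by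
  obtain ⟨n, f, g, -, -, h⟩ := Module.Finite.exists_comp_eq_id_of_projective A P
  refine ⟨n, fun k => (LinearMap.proj k).comp g, fun k => f (Pi.single k 1), fun x => ?_⟩
  have h' : f (g x) = x := LinearMap.congr_fun h x
  conv_rhs => rw [← h', ← Finset.univ_sum_single (g x), map_sum]
  refine Finset.sum_congr rfl fun k _ => ?_
  rw [← map_smul]
  congr 1
  ext i
  by_cases hi : i = k
  · subst hi; simp
  · simp [hi]

theorem serreAux_bijective [Module.Projective A P] : Function.Bijective (serreAux F P M) := by
  obtain ⟨n, c, b, hb⟩ := exists_dual_basis P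
  constructor
  · intro ξ η h
    refine LinearMap.ext fun f => ?_
    have hf : f = ∑ k, rankOne (c k) (f.hom.hom (b k)) := by
      refine FGModuleCat.hom_ext (LinearMap.ext fun x => ?_)
      let ev : (P ⟶ M) →+ M :=
        { toFun := fun u => u.hom.hom x
          map_zero' := rfl
          map_add' := fun _ _ => rfl }
      refine Eq.trans ?_ (map_sum ev (fun k => rankOne (c k) (f.hom.hom (b k))) Finset.univ).symm
      conv_lhs => rw [← hb x, map_sum]
      exact Finset.sum_congr rfl fun k _ => map_smul f.hom.hom _ _
    rw [hf, map_sum, map_sum]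
    refine Finset.sum_congr rfl fun k _ => ?_
    rw [← serreAux_apply, ← serreAux_apply, h]
  · intro h
    let hh : M →ₗ[A] DualR F (P →ₗ[A] A) := h.hom.hom
    have hsmul : ∀ (r : F) (m : M), hh (r • m) = r • hh m := fun r m => by
      rw [← algebraMap_smul A r m, map_smul, algebraMap_smul]
    refine ⟨{ toFun := fun f => ∑ k, hh (f.hom.hom (b k)) (c k)
              map_add' := fun f g => ?_
              map_smul' := fun r f => ?_ }, ?_⟩
    · rw [← Finset.sum_add_distrib]
      refine Finset.sum_congr rfl fun k _ => ?_
      change hh (f.hom.hom (b k) + g.hom.hom (b k)) (c k) = _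
      rw [map_add]
      rfl
    · rw [RingHom.id_apply, Finset.smul_sum]
      refine Finset.sum_congr rfl fun k _ => ?_
      change hh (r • f.hom.hom (b k)) (c k) = _
      rw [hsmul]
      rfl
    · refine FGModuleCat.hom_ext (LinearMap.ext fun m => DualR.ext F fun φ => ?_)
      change ∑ k, hh (φ (b k) • m) (c k) = hh m φ
      have hφ : φ = ∑ k, MulOpposite.op (φ (b k)) • c k := by
        refine LinearMap.ext fun x => ?_
        conv_lhs => rw [← hb x, map_sum]
        rw [LinearMap.sum_apply]
        exact Finset.sum_congr rfl fun k _ => map_smul φ _ _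
      conv_rhs => rw [hφ, map_sum]
      refine Finset.sum_congr rfl fun k _ => ?_
      rw [map_smul]
      rfl

/-- Serre duality `Hom (P, M) ≅ Hom (M, ν P)^*` for `P` finitely generated projective: the
composition of the evaluation map to the double dual with the dual of the isomorphism
`Hom (P, M)^* ≅ Hom (M, ν P)`. -/
def serre [Module.Projective A P] : (P ⟶ M) ≃ₗ[F] Module.Dual F (M ⟶ (nu F A).obj P) :=
  Module.evalEquiv F (P ⟶ M) ≪≫ₗ
    (LinearEquiv.ofBijective (serreAux F P M) (serreAux_bijective F P M)).symm.dualMap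

/-- Serre duality sends the image `p ↦ φ p • m` of `φ ⊗ m ∈ P^∨ ⊗ M` to the functional
`h ↦ h m φ`; this determines it, since the maps `p ↦ φ p • m` span `Hom (P, M)`. -/
theorem serre_rankOne [Module.Projective A P] (φ : P →ₗ[A] A) (m : M)
    (h : M ⟶ (nu F A).obj P) :
    serre F P M (rankOne φ m) h = (show DualR F (P →ₗ[A] A) from h.hom.hom m) φ := by
  obtain ⟨ξ, rfl⟩ := (serreAux_bijective F P M).2 h
  rw [serreAux_apply]
  change (LinearEquiv.ofBijective (serreAux F P M) (serreAux_bijective F P M)).symm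
    ((LinearEquiv.ofBijective (serreAux F P M) (serreAux_bijective F P M)) ξ) (rankOne φ m) = _
  rw [LinearEquiv.symm_apply_apply]

end Serre

/-! ### The map `Δ` -/

section DeltaMap

variable (F : Type u) [Field F] {A : Type u} [Ring A] [Algebra F A] [Module.Finite F A]
variable {L R : FGModuleCat.{u} A ⥤ FGModuleCat.{u} A} (adj : L ⊣ R) [R.Additive] [R.Linear F]

/-- For an adjunction `L ⊣ R` and `P`, `Q` finitely generated projective, the composition
`Hom (P, L ^ r Q) ≅ Hom (L ^ r Q, ν P)^* ≅ Hom (Q, R ^ r (ν P))^* ≅ Hom (R ^ r (ν P), ν Q)^{**}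
≅ Hom (R ^ r (ν P), ν Q)` of Serre duality, the adjunction, Serre duality and evaluation. -/
def delta (P Q : FGModuleCat.{u} A) [Module.Projective A P] [Module.Projective A Q] (r : ℕ) :
    (P ⟶ (iterL L r).obj Q) ≃ₗ[F] ((iterR R r).obj ((nu F A).obj P) ⟶ (nu F A).obj Q) :=
  serre F P ((iterL L r).obj Q) ≪≫ₗ
    (iterHomEquiv F adj r Q ((nu F A).obj P)).symm.dualMap ≪≫ₗ
    (serre F Q ((iterR R r).obj ((nu F A).obj P))).symm.dualMap ≪≫ₗ
    (Module.evalEquiv F ((iterR R r).obj ((nu F A).obj P) ⟶ (nu F A).obj Q)).symm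

variable (A)

/-- The regular left module `A`. -/
abbrev regular : FGModuleCat.{u} A := FGModuleCat.of A A

instance : Module.Projective A (regular A) := inferInstanceAs (Module.Projective A A)

instance : Module.Finite A (DualR F A) := Module.Finite.of_restrictScalars_finite F A _

/-- The left module `A^*`, the dual of the regular right module. -/
abbrev coregular : FGModuleCat.{u} A := FGModuleCat.of A (DualR F A)

/-- The isomorphism of right modules `A ≅ A^∨`, `a ↦ (x ↦ x a)`. -/
def regularDual : A ≃ₗ[Aᵐᵒᵖ] (A →ₗ[A] A) where
  toFun a := LinearMap.toSpanSingleton A A a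
  invFun φ := φ 1
  map_add' a b := LinearMap.ext fun x => mul_add x a b
  map_smul' c a := LinearMap.ext fun x => (mul_assoc x a c.unop).symm
  left_inv a := one_mul a
  right_inv φ := LinearMap.ext fun x => by
    change x * φ 1 = φ x
    rw [← smul_eq_mul, ← map_smul, smul_eq_mul, mul_one]

/-- The isomorphism `ν A = A^{∨*} ≅ A^*` induced by `A ≅ A^∨`. -/
def nuRegular : (nu F A).obj (regular A) ≅ coregular F A where
  hom := FGModuleCat.ofHom (DualR.map F (regularDual A).toLinearMap)
  inv := FGModuleCat.ofHom (DualR.map F (regularDual A).symm.toLinearMap)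
  hom_inv_id := FGModuleCat.hom_ext <| LinearMap.ext fun ξ => DualR.ext F fun φ =>
    congrArg (show DualR F (A →ₗ[A] A) from ξ) ((regularDual A).apply_symm_apply φ)
  inv_hom_id := FGModuleCat.hom_ext <| LinearMap.ext fun ξ => DualR.ext F fun a =>
    congrArg (show DualR F A from ξ) ((regularDual A).symm_apply_apply a)

/-- The preprojective algebra `Π = ⨁ r, Hom (A, τ^{-r} A)`, in which the product of `g` in
degree `s` and `f` in degree `r` is `τ^{-r} g ∘ f`. -/
abbrev Preprojective : Type u := ⨁ r, LPiece (tauInv F A) (regular A) r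

/-- The postinjective algebra `⨁ r, Hom (τ^r A^*, A^*)`, in which the product of `g` in
degree `s` and `f` in degree `r` is `g ∘ τ^s f`. -/
abbrev Postinjective : Type u := ⨁ r, RPiece (tau F A) (coregular F A) r

/-- The element of degree `r` of the preprojective algebra given by `A → τ^{-r} A`. -/
def Preprojective.of (r : ℕ) (f : regular A ⟶ (iterL (tauInv F A) r).obj (regular A)) :
    Preprojective F A :=
  DirectSum.lof F ℕ (LPiece (tauInv F A) (regular A)) r f

/-- The element of degree `r` of the postinjective algebra given by `τ^r A^* → A^*`. -/
def Postinjective.of (r : ℕ) (g : (iterR (tau F A) r).obj (coregular F A) ⟶ coregular F A) :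
    Postinjective F A :=
  DirectSum.lof F ℕ (RPiece (tau F A) (coregular F A)) r g

/-- The degree `r` part of the preprojective algebra. -/
def Preprojective.degree (r : ℕ) : Submodule F (Preprojective F A) :=
  LinearMap.range (DirectSum.lof F ℕ (LPiece (tauInv F A) (regular A)) r)

/-- The degree `r` part of the postinjective algebra. -/
def Postinjective.degree (r : ℕ) : Submodule F (Postinjective F A) :=
  LinearMap.range (DirectSum.lof F ℕ (RPiece (tau F A) (coregular F A)) r)

variable {A}

/-- The map `Δ` in degree `r`: the map `delta` for `P = Q = A`, followed by the identification
of `ν A` with `A^*`. -/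
def deltaRegular (adj : tauInv F A ⊣ tau F A) (r : ℕ) :
    LPiece (tauInv F A) (regular A) r →ₗ[F] RPiece (tau F A) (coregular F A) r where
  toFun f := (iterR (tau F A) r).map (nuRegular F A).inv ≫
    delta F adj (regular A) (regular A) r f ≫ (nuRegular F A).hom
  map_add' f g := by
    refine (congrArg (fun k => _ ≫ k ≫ _)
      (map_add (delta F adj (regular A) (regular A) r) f g)).trans ?_
    rw [Preadditive.add_comp, Preadditive.comp_add]
    rfl
  map_smul' c f := by
    refine (congrArg (fun k => _ ≫ k ≫ _)
      (map_smul (delta F adj (regular A) (regular A) r) c f)).trans ?_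
    rw [Linear.smul_comp, Linear.comp_smul]
    rfl

/-- The map `Δ` from the preprojective to the postinjective algebra. -/
def Delta (adj : tauInv F A ⊣ tau F A) : Preprojective F A →ₗ[F] Postinjective F A :=
  DirectSum.lmap (deltaRegular F adj)

end DeltaMap

end

end HereditaryAlgebra

/-! For `P` finitely generated projective, `serre F P M u v` is a bilinear pairing ⟨u, v⟩ of maps u
: P ⟶ M and v : M ⟶ νP. It is nondegenerate, and natural in `M` and in `P` (`serre_comp`,
`serre_nu`). Unwinding the double duals in Δ^r shows that Δ^r f is the only map with ⟨h, Δ^r f⟩ =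
⟨f, h♭⟩ for all h : Q ⟶ τ^r νP, where h♭ : τ^{-r} Q ⟶ νP is the adjunct of h (`serre_delta`,
`ext_of_serre`).

So identities for Δ are tested against an arbitrary h. By naturality of the pairing and of the
adjunction, ⟨h, Δg ∘ τ^s Δf⟩ and ⟨h, Δ(τ^{-r} g ∘ f)⟩ both equal ⟨f, h♭ ∘ τ^{-r} g⟩, because the
adjunct for s + r is obtained by taking the adjunct for s and then for r
(`iterAdj_homEquiv_symm_add`). This is `delta_mul`; the formula on components, `delta_comp`, is
proved in the same way. The argument is formal in the adjunction, so any choice will do.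

The adjunction itself is the chain Hom(τ⁻M, N) ≅ Ext¹(M^*, N^*)^* ≅ Ext¹(N, M)^* ≅ Hom(M, τN). In
the middle, Ext¹(N, M) is the space of derivations of `A` in Hom_F(N, M) modulo inner ones, and
derivations can be transposed (`ExtDual.transposeEquiv`). At the ends heredity enters: the syzygy of
N is finitely generated projective, so Ext¹(N, M) ≅ Ext¹(N, A) ⊗_A M, whose dual is Hom_A(M, Ext¹(N,
A)^*) (`ExtDual.toHomTau_bijective`, `ExtDual.toHomExt_bijective`). For right modules the
projectivity of syzygies is deduced from left heredity by duality (`projective_syz_op`). -/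

namespace HereditaryAlgebra

noncomputable section

/-! ### Iterated adjunctions -/

section IteratedAdjunction

variable {C : Type u} [Category.{v} C] {L R : C ⥤ C}

theorem id_homEquiv_symm {X Y : C} (h : X ⟶ Y) :
    ((Adjunction.id (C := C)).homEquiv X Y).symm h = h := by
  rw [Adjunction.homEquiv_counit]
  exact Category.comp_id h

/-- This is the source of multiplicativity: passing to adjuncts is compatible with adding exponents.
The `eqToHom` factors only identify iterates that are equal as functors. -/
theorem iterAdj_homEquiv_symm_add (adj : L ⊣ R) (s r : ℕ) (X Y : C)
    (h : X ⟶ (iterR R (s + r)).obj Y) :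
    ((iterAdj adj (s + r)).homEquiv X Y).symm h =
      eqToHom (iterL_obj L s r X).symm ≫
        ((iterAdj adj r).homEquiv ((iterL L s).obj X) Y).symm
          (((iterAdj adj s).homEquiv X ((iterR R r).obj Y)).symm
            (h ≫ eqToHom (iterR_obj R s r Y).symm)) := by
  -- `iterR` applies the extra `R` to `Y` first, so the induction hypothesis is needed at `R.obj Y`.
  induction r generalizing Y with
  | zero =>
    change _ = 𝟙 _ ≫ ((Adjunction.id.homEquiv ((iterL L s).obj X) Y).symm
      (((iterAdj adj s).homEquiv X Y).symm (h ≫ 𝟙 _)))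
    rw [Category.id_comp, Category.comp_id]
    exact (id_homEquiv_symm _).symm
  | succ r ih =>
    change (((iterAdj adj (s + r)).comp adj).homEquiv X Y).symm h = eqToHom _ ≫
      (((iterAdj adj r).comp adj).homEquiv ((iterL L s).obj X) Y).symm
        (((iterAdj adj s).homEquiv X ((iterR R r).obj (R.obj Y))).symm (h ≫ eqToHom _))
    rw [Adjunction.comp_homEquiv, Adjunction.comp_homEquiv]
    change (adj.homEquiv ((iterL L (s + r)).obj X) Y).symm
      (((iterAdj adj (s + r)).homEquiv X (R.obj Y)).symm h) = eqToHom _ ≫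
        (adj.homEquiv ((iterL L r).obj ((iterL L s).obj X)) Y).symm
          (((iterAdj adj r).homEquiv ((iterL L s).obj X) (R.obj Y)).symm
            (((iterAdj adj s).homEquiv X ((iterR R r).obj (R.obj Y))).symm (h ≫ eqToHom _)))
    refine (congrArg (adj.homEquiv ((iterL L (s + r)).obj X) Y).symm (ih (R.obj Y) h)).trans ?_
    rw [Adjunction.homEquiv_naturality_left_symm, eqToHom_map]
    rfl

theorem iterR_map_add (s r : ℕ) {Y Y' : C} (f : Y ⟶ Y') :
    (iterR R (s + r)).map f = eqToHom (iterR_obj R s r Y).symm ≫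
      (iterR R s).map ((iterR R r).map f) ≫ eqToHom (iterR_obj R s r Y') :=
  Functor.congr_hom (iterR_comp R s r).symm f

/-- Used to carry multiplicativity from endomorphisms of ν`A` to endomorphisms of `A`^*: in the
product of the two conjugates the inner factors `R ^ s i.hom` and `R ^ s i.inv` cancel. -/
theorem iterR_conj_mul (s r : ℕ) {Y Y' : C} (i : Y ≅ Y') (f : (iterR R r).obj Y ⟶ Y)
    (g : (iterR R s).obj Y ⟶ Y) :
    (iterR R (s + r)).map i.inv ≫
        (eqToHom (iterR_obj R s r Y).symm ≫ (iterR R s).map f ≫ g) ≫ i.hom =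
      eqToHom (iterR_obj R s r Y').symm ≫
        (iterR R s).map ((iterR R r).map i.inv ≫ f ≫ i.hom) ≫
          (iterR R s).map i.inv ≫ g ≫ i.hom := by
  have h : (iterR R s).map i.hom ≫ (iterR R s).map i.inv = 𝟙 _ := by
    rw [← Functor.map_comp, Iso.hom_inv_id, CategoryTheory.Functor.map_id]
  rw [iterR_map_add]
  simp [reassoc_of% h]

end IteratedAdjunction

/-! ### Naturality and nondegeneracy of the Serre pairing -/

section SerrePairing

variable (F : Type u) [Field F] {A : Type u} [Ring A] [Algebra F A] [Module.Finite F A]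

/-- A dual basis of `P` writes every map as a sum of rank-one maps, the maps on which
`serre_rankOne` computes the pairing. -/
theorem hom_induction_rankOne {P M : FGModuleCat.{u} A} [Module.Projective A P]
    {p : (P ⟶ M) → Prop} (zero : p 0) (add : ∀ u v, p u → p v → p (u + v))
    (rankOne : ∀ (φ : P →ₗ[A] A) (m : M), p (rankOne φ m)) (u : P ⟶ M) : p u := by
  obtain ⟨n, c, b, hb⟩ := exists_dual_basis P
  have hu : u = ∑ k, HereditaryAlgebra.rankOne (c k) (u.hom.hom (b k)) := by
    refine FGModuleCat.hom_ext (LinearMap.ext fun x => ?_)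
    let ev : (P ⟶ M) →+ M :=
      { toFun := fun u => u.hom.hom x
        map_zero' := rfl
        map_add' := fun _ _ => rfl }
    refine Eq.trans ?_
      (map_sum ev (fun k => HereditaryAlgebra.rankOne (c k) (u.hom.hom (b k))) Finset.univ).symm
    conv_lhs => rw [← hb x, map_sum]
    exact Finset.sum_congr rfl fun k _ => map_smul u.hom.hom _ _
  rw [hu]
  exact Finset.sum_induction _ p (fun _ _ => add _ _) zero fun k _ => rankOne _ _

theorem serre_comp {P M N : FGModuleCat.{u} A} [Module.Projective A P] (u : P ⟶ M) (m : M ⟶ N)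
    (v : N ⟶ (nu F A).obj P) : serre F P N (u ≫ m) v = serre F P M u (m ≫ v) := by
  induction u using hom_induction_rankOne with
  | zero => rw [Limits.zero_comp, map_zero, map_zero]; rfl
  | add u w hu hw => rw [Preadditive.add_comp, map_add, map_add, LinearMap.add_apply, hu, hw]; rfl
  | rankOne φ x =>
    have h : rankOne φ x ≫ m = rankOne φ (m.hom.hom x) :=
      FGModuleCat.hom_ext (LinearMap.ext fun p => map_smul m.hom.hom (φ p) x)
    rw [h, serre_rankOne, serre_rankOne]
    rfl

theorem serre_nu {P P' M : FGModuleCat.{u} A} [Module.Projective A P] [Module.Projective A P']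
    (a : P' ⟶ P) (u : P ⟶ M) (v : M ⟶ (nu F A).obj P') :
    serre F P' M (a ≫ u) v = serre F P M u (v ≫ (nu F A).map a) := by
  induction u using hom_induction_rankOne with
  | zero => rw [Limits.comp_zero, map_zero, map_zero]; rfl
  | add u w hu hw => rw [Preadditive.comp_add, map_add, map_add, LinearMap.add_apply, hu, hw]; rfl
  | rankOne φ x =>
    have h : a ≫ rankOne φ x = rankOne (φ.comp a.hom.hom) x := rfl
    rw [h, serre_rankOne, serre_rankOne]
    rfl

/-- `serre` is onto the dual space, so the functionals ⟨u, -⟩ are all functionals, and these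
separate points. -/
theorem ext_of_serre {P M : FGModuleCat.{u} A} [Module.Projective A P]
    {v w : M ⟶ (nu F A).obj P} (h : ∀ u, serre F P M u v = serre F P M u w) : v = w := by
  refine (Module.forall_dual_apply_eq_zero_iff F (v - w)).1 (fun ξ => ?_) |> sub_eq_zero.1
  rw [map_sub, sub_eq_zero, ← (serre F P M).apply_symm_apply ξ]
  exact h _

end SerrePairing

/-! ### Formal properties of Δ^r for an arbitrary adjunction -/

section DeltaProperties

variable (F : Type u) [Field F] {A : Type u} [Ring A] [Algebra F A] [Module.Finite F A]
variable {L R : FGModuleCat.{u} A ⥤ FGModuleCat.{u} A} (adj : L ⊣ R) [R.Additive] [R.Linear F]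

/-- Together with `ext_of_serre` this characterises `delta`; its compatibility with composition is
derived from this identity instead of the chain of isomorphisms. -/
theorem serre_delta (P Q : FGModuleCat.{u} A) [Module.Projective A P] [Module.Projective A Q]
    (r : ℕ) (f : P ⟶ (iterL L r).obj Q) (h : Q ⟶ (iterR R r).obj ((nu F A).obj P)) :
    serre F Q _ h (delta F adj P Q r f) =
      serre F P _ f (((iterAdj adj r).homEquiv _ _).symm h) := by
  -- The inverse of the evaluation map is only accessible under a functional; the case needed is ξ =
  -- ⟨h, -⟩.
  have h1 : ∀ ξ : Module.Dual F ((iterR R r).obj ((nu F A).obj P) ⟶ (nu F A).obj Q),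
      ξ (delta F adj P Q r f) =
      serre F P _ f (((iterAdj adj r).homEquiv _ _).symm ((serre F Q _).symm ξ)) := by
    intro ξ
    change ξ ((Module.evalEquiv F _).symm _) = _
    rw [Module.apply_evalEquiv_symm_apply]
    rfl
  rw [h1, LinearEquiv.symm_apply_apply]

theorem delta_comp (P Q P' Q' : FGModuleCat.{u} A) [Module.Projective A P]
    [Module.Projective A Q] [Module.Projective A P'] [Module.Projective A Q'] (r : ℕ)
    (a : P' ⟶ P) (b : Q ⟶ Q') (f : P ⟶ (iterL L r).obj Q) :
    delta F adj P' Q' r (a ≫ f ≫ (iterL L r).map b) =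
      (iterR R r).map ((nu F A).map a) ≫ delta F adj P Q r f ≫ (nu F A).map b := by
  refine ext_of_serre F fun h => ?_
  refine (serre_delta F adj P' Q' r _ h).trans ?_
  refine Eq.trans ?_ (serre_comp F h ((iterR R r).map ((nu F A).map a)) _)
  refine Eq.trans ?_ (serre_nu F b _ _)
  refine Eq.trans ?_ (serre_delta F adj P Q r f _).symm
  rw [Adjunction.homEquiv_naturality_left_symm, Adjunction.homEquiv_naturality_right_symm,
    serre_nu, serre_comp]

/-- Write ♭ₛ, ♭ᵣ for adjuncts. Suppressing `eqToHom`, ⟨h, τ^s Δf ≫ Δg⟩ = ⟨g, h♭ₛ ≫ Δf⟩ = ⟨g ≫ h♭ₛ,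
Δf⟩ = ⟨f, τ^{-r} g ≫ h♭ₛ♭ᵣ⟩, and h♭ₛ♭ᵣ is the adjunct of h for s + r. Here `L` and `R` play the
roles of τ⁻ and τ. -/
theorem delta_mul (P Q S : FGModuleCat.{u} A) [Module.Projective A P]
    [Module.Projective A Q] [Module.Projective A S] (s r : ℕ)
    (f : P ⟶ (iterL L r).obj Q) (g : Q ⟶ (iterL L s).obj S) :
    delta F adj P S (s + r) (f ≫ (iterL L r).map g ≫ eqToHom (iterL_obj L s r S)) =
      eqToHom (iterR_obj R s r _).symm ≫ (iterR R s).map (delta F adj P Q r f) ≫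
        delta F adj Q S s g := by
  refine ext_of_serre F fun h => ?_
  refine (serre_delta F adj P S (s + r) _ h).trans ?_
  rw [iterAdj_homEquiv_symm_add]
  refine Eq.trans ?_ (serre_comp F h (eqToHom _) _)
  refine Eq.trans ?_ (serre_comp F _ ((iterR R s).map (delta F adj P Q r f)) _)
  refine Eq.trans ?_ (serre_delta F adj Q S s g _).symm
  rw [Adjunction.homEquiv_naturality_right_symm]
  refine Eq.trans ?_ (serre_comp F g _ _)
  refine Eq.trans ?_ (serre_delta F adj P Q r f _).symm
  rw [Adjunction.homEquiv_naturality_left_symm _ g, ← serre_comp, ← serre_comp]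
  simp

theorem delta_one (P : FGModuleCat.{u} A) [Module.Projective A P] :
    delta F adj P P 0 (𝟙 P) = 𝟙 ((nu F A).obj P) := by
  refine ext_of_serre F fun h => ?_
  refine (serre_delta F adj P P 0 (𝟙 P) h).trans ?_
  have h0 : ((iterAdj adj 0).homEquiv P ((nu F A).obj P)).symm h = h := by
    change (Adjunction.id.homEquiv P ((nu F A).obj P)).symm h = h
    exact id_homEquiv_symm h
  rw [h0]
  have := serre_comp F (𝟙 P) (show P ⟶ (nu F A).obj P from h) (𝟙 _)
  rw [Category.id_comp, Category.comp_id] at this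
  exact this.symm

end DeltaProperties

/-! ### Δ as an isomorphism of graded algebras -/

section DeltaIsomorphism

variable (F : Type u) [Field F] {A : Type u} [Ring A] [Algebra F A] [Module.Finite F A]
variable (adj : tauInv F A ⊣ tau F A)

theorem deltaRegular_mul {s r : ℕ} (g : LPiece (tauInv F A) (regular A) s)
    (f : LPiece (tauInv F A) (regular A) r) :
    deltaRegular F adj (s + r) (LPiece.mul g f) =
      RPiece.mul (deltaRegular F adj s g) (deltaRegular F adj r f) := by
  refine Eq.trans ?_ (iterR_conj_mul s r (nuRegular F A)
    (delta F adj (regular A) (regular A) r f) (delta F adj (regular A) (regular A) s g))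
  exact congrArg (fun k => (iterR (tau F A) (s + r)).map (nuRegular F A).inv ≫ k ≫
    (nuRegular F A).hom) (delta_mul F adj (regular A) (regular A) (regular A) s r f g)

theorem deltaRegular_one :
    deltaRegular F adj 0 (𝟙 (regular A) : regular A ⟶ regular A) =
      (𝟙 (coregular F A) : coregular F A ⟶ coregular F A) := by
  change (nuRegular F A).inv ≫ delta F adj (regular A) (regular A) 0 (𝟙 _) ≫
    (nuRegular F A).hom = 𝟙 _
  rw [delta_one]
  exact (congrArg _ (Category.id_comp _)).trans (Iso.inv_hom_id _)

theorem deltaRegular_bijective (r : ℕ) : Function.Bijective (deltaRegular F adj r) := by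
  -- Conjugation by the isomorphism ν`A` ≅ `A`^* is bijective, and `delta` is already a linear
  -- equivalence.
  have h1 : Function.Bijective (fun k => (iterR (tau F A) r).map (nuRegular F A).inv ≫ k ≫
      (nuRegular F A).hom) := by
    exact (Iso.homCongr ((iterR (tau F A) r).mapIso (nuRegular F A)) (nuRegular F A)).bijective
  exact h1.comp (delta F adj (regular A) (regular A) r).bijective

theorem Delta_of (r : ℕ) (f : LPiece (tauInv F A) (regular A) r) :
    Delta F adj (DirectSum.lof F ℕ _ r f) = DirectSum.lof F ℕ _ r (deltaRegular F adj r f) :=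
  DirectSum.lmap_lof _ _ _

theorem Delta_one : Delta F adj 1 = 1 :=
  (Delta_of F adj 0 _).trans (congrArg _ (deltaRegular_one F adj))

theorem Delta_mul (x y : Preprojective F A) :
    Delta F adj (x * y) = Delta F adj x * Delta F adj y := by
  induction x using DirectSum.induction_on with
  | zero => simp
  | add a b ha hb => rw [add_mul, map_add, ha, hb, map_add, add_mul]
  | of i a =>
    induction y using DirectSum.induction_on with
    | zero => simp
    | add a b ha hb => rw [mul_add, map_add, ha, hb, map_add, mul_add]
    | of j b =>
      rw [DirectSum.of_mul_of]
      refine (Delta_of F adj _ _).trans ?_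
      refine Eq.trans ?_ (congrArg₂ (· * ·) (Delta_of F adj i a) (Delta_of F adj j b)).symm
      refine Eq.trans ?_ (DirectSum.of_mul_of _ _).symm
      exact congrArg _ (deltaRegular_mul F adj a b)

theorem Delta_bijective : Function.Bijective (Delta F adj) :=
  ⟨(DirectSum.lmap_injective _).2 fun r => (deltaRegular_bijective F adj r).1,
    (DirectSum.lmap_surjective _).2 fun r => (deltaRegular_bijective F adj r).2⟩

/-- The map `Δ` as an isomorphism of algebras. -/
def DeltaEquiv : Preprojective F A ≃ₐ[F] Postinjective F A :=
  AlgEquiv.ofLinearEquiv (LinearEquiv.ofBijective (Delta F adj) (Delta_bijective F adj))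
    (Delta_one F adj) (Delta_mul F adj)

theorem map_degree_Delta (r : ℕ) : (Preprojective.degree F A r).map (Delta F adj) =
    Postinjective.degree F A r := by
  rw [Preprojective.degree, Postinjective.degree, ← LinearMap.range_comp]
  have : Delta F adj ∘ₗ DirectSum.lof F ℕ _ r =
      DirectSum.lof F ℕ _ r ∘ₗ deltaRegular F adj r := LinearMap.ext fun f => Delta_of F adj r f
  rw [this, LinearMap.range_comp, LinearMap.range_eq_top.2 (deltaRegular_bijective F adj r).2,
    Submodule.map_top]

theorem Delta_component (P Q : FGModuleCat.{u} A) [Module.Projective A P] [Module.Projective A Q]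
    (r : ℕ) (a : regular A ⟶ P) (b : Q ⟶ regular A) (f : P ⟶ (iterL (tauInv F A) r).obj Q) :
    Delta F adj (Preprojective.of F A r (a ≫ f ≫ (iterL (tauInv F A) r).map b)) =
      Postinjective.of F A r ((iterR (tau F A) r).map ((nuRegular F A).inv ≫ (nu F A).map a) ≫
        delta F adj P Q r f ≫ (nu F A).map b ≫ (nuRegular F A).hom) := by
  refine (Delta_of F adj r _).trans (congrArg (DirectSum.lof F ℕ _ r) ?_)
  change (iterR (tau F A) r).map (nuRegular F A).inv ≫
    delta F adj (regular A) (regular A) r (a ≫ f ≫ (iterL (tauInv F A) r).map b) ≫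
      (nuRegular F A).hom = _
  rw [delta_comp]
  simp only [Functor.map_comp, Category.assoc]

end DeltaIsomorphism

/-! ### `Ext¹` as derivations modulo inner derivations -/

section Cocycles

variable (F : Type u) [Field F] (A : Type u) [Ring A] [Algebra F A]
variable (N M : Type u) [AddCommGroup N] [Module F N] [Module A N] [IsScalarTower F A N]
  [AddCommGroup M] [Module F M] [Module A M] [IsScalarTower F A M]

/-- The derivations of `A` with values in the bimodule `Hom_F (N, M)`. -/
def Cocycle : Submodule F (A →ₗ[F] N →ₗ[F] M) where
  carrier := {δ | ∀ a b n, δ (a * b) n = a • δ b n + δ a (b • n)}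
  zero_mem' a b n := by simp
  add_mem' {δ ε} hδ hε a b n := by
    simp only [LinearMap.add_apply, hδ a b n, hε a b n, smul_add]
    abel
  smul_mem' c δ hδ a b n := by
    simp only [LinearMap.smul_apply, hδ a b n, smul_add, smul_comm c a]

variable {N M}

/-- The generator `a ⊗ n - 1 ⊗ a n` of the kernel of the free cover. -/
def syzGen (a : A) (n : N) : Syz F A N :=
  ⟨a ⊗ₜ n - 1 ⊗ₜ (a • n), by simp [cover]⟩

variable {A}

set_option linter.unusedSectionVars false in
theorem Cocycle.map_mul (δ : Cocycle F A N M) (a b : A) (n : N) :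
    δ.1 (a * b) n = a • δ.1 b n + δ.1 a (b • n) := δ.2 a b n

theorem Cocycle.map_one (δ : Cocycle F A N M) (n : N) : δ.1 1 n = 0 := by
  simpa using Cocycle.map_mul F δ 1 1 n

set_option linter.unusedSectionVars false in
@[ext] theorem Cocycle.ext {δ ε : Cocycle F A N M} (h : ∀ a n, δ.1 a n = ε.1 a n) : δ = ε :=
  Subtype.ext (LinearMap.ext fun a => LinearMap.ext fun n => h a n)

/-- The failure of linearity over `A` is a term depending on `cover F A N x` alone, so it disappears
on the syzygy. -/
theorem lift_smul_cocycle (δ : Cocycle F A N M) (b : A) (x : A ⊗[F] N) :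
    TensorProduct.lift δ.1 (b • x) =
      b • TensorProduct.lift δ.1 x + δ.1 b (cover F A N x) := by
  induction x with
  | zero => simp
  | add x y hx hy => rw [smul_add, map_add, hx, hy, map_add, map_add, map_add, smul_add]; abel
  | tmul a n => simpa [cover, TensorProduct.smul_tmul'] using Cocycle.map_mul F δ b a n

/-- The derivation `a ↦ (n ↦ u (a ⊗ n - 1 ⊗ a n))`. -/
def cocycleOf : (Syz F A N →ₗ[A] M) →ₗ[F] Cocycle F A N M where
  toFun u := ⟨LinearMap.mk₂ F (fun a n => u (syzGen F A a n))
    (fun a b n => by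
      rw [← map_add]; congr 1; ext1
      simp only [syzGen, Submodule.coe_add, TensorProduct.add_tmul, add_smul,
        TensorProduct.tmul_add]
      abel)
    (fun c a n => by
      rw [← LinearMap.map_smul_of_tower]; congr 1; ext1
      change _ = c • _
      simp only [syzGen, smul_sub, TensorProduct.smul_tmul', smul_assoc, TensorProduct.tmul_smul])
    (fun a n p => by
      rw [← map_add]; congr 1; ext1
      simp only [syzGen, Submodule.coe_add, smul_add, TensorProduct.tmul_add]
      abel)
    (fun c a n => by
      rw [← LinearMap.map_smul_of_tower]; congr 1; ext1
      change _ = c • _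
      simp only [syzGen, smul_sub, TensorProduct.tmul_smul, smul_comm a c n]),
    fun a b n => by
      simp only [LinearMap.mk₂_apply]
      rw [← map_smul, ← map_add]; congr 1; ext1
      simp only [syzGen, Submodule.coe_add, Submodule.coe_smul, smul_sub,
        TensorProduct.smul_tmul', smul_eq_mul, mul_one, mul_smul]
      abel⟩
  map_add' _ _ := rfl
  map_smul' _ _ := rfl

theorem lift_cocycleOf (u : Syz F A N →ₗ[A] M) (x : Syz F A N) :
    TensorProduct.lift (cocycleOf F u).1 x = u x := by
  -- Induction on tensors does not stay inside the syzygy. The projection y ↦ y - 1 ⊗ cover y onto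
  -- it allows a statement about all tensors, which returns the claim when cover y = 0.
  have h : ∀ y : A ⊗[F] N, ∃ z : Syz F A N, (z : A ⊗[F] N) = y - 1 ⊗ₜ cover F A N y ∧
      TensorProduct.lift (cocycleOf F u).1 y = u z := by
    intro y
    induction y with
    | zero => exact ⟨0, by simp, by simp⟩
    | add x y hx hy =>
      obtain ⟨z, hz, hz'⟩ := hx
      obtain ⟨w, hw, hw'⟩ := hy
      refine ⟨z + w, ?_, by rw [map_add, hz', hw', map_add]⟩
      rw [Submodule.coe_add, hz, hw, map_add, TensorProduct.tmul_add]
      abel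
    | tmul a n => exact ⟨syzGen F A a n, by simp [syzGen, cover], rfl⟩
  obtain ⟨z, hz, hz'⟩ := h x
  rw [hz']
  congr 1
  ext1
  rw [hz, LinearMap.mem_ker.1 x.2, TensorProduct.tmul_zero, sub_zero]

theorem cocycleOf_bijective :
    Function.Bijective (cocycleOf F : (Syz F A N →ₗ[A] M) →ₗ[F] Cocycle F A N M) := by
  constructor
  · intro u v h
    refine LinearMap.ext fun x => ?_
    rw [← lift_cocycleOf, h, lift_cocycleOf]
  · intro δ
    refine ⟨{ toFun := fun x => TensorProduct.lift δ.1 x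
              map_add' := fun x y => map_add (TensorProduct.lift δ.1) (x : A ⊗[F] N) y
              map_smul' := fun a x => ?_ }, ?_⟩
    · refine (lift_smul_cocycle F δ a x).trans ?_
      rw [LinearMap.mem_ker.1 x.2, map_zero, add_zero]
      rfl
    · refine Cocycle.ext F fun a n => ?_
      change TensorProduct.lift δ.1 (a ⊗ₜ n - 1 ⊗ₜ (a • n)) = _
      rw [map_sub, TensorProduct.lift.tmul, TensorProduct.lift.tmul, Cocycle.map_one F δ, sub_zero]

variable (A) in
/-- The inner derivation `a ↦ a f - f a`. -/
def innerCocycle (f : N →ₗ[F] M) : Cocycle F A N M :=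
  ⟨LinearMap.mk₂ F (fun a n => a • f n - f (a • n))
    (fun a b n => by simp only [add_smul, map_add]; abel)
    (fun c a n => by simp only [smul_assoc, map_smul, smul_sub])
    (fun a n p => by simp only [smul_add, map_add]; abel)
    (fun c a n => by simp only [map_smul, smul_comm a c, smul_sub]),
    fun a b n => by
      simp only [LinearMap.mk₂_apply, mul_smul, smul_sub]
      abel⟩

/-- Maps that extend to the free cover give inner derivations; with
`exists_cocycleOf_restrict_eq_inner` these are all the inner derivations, so the cokernel defining
`ExtOne` is matched. -/
theorem cocycleOf_restrict (ψ : A ⊗[F] N →ₗ[A] M) :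
    cocycleOf F (ψ.comp (Syz F A N).subtype) =
      innerCocycle F A ((ψ.restrictScalars F).comp (TensorProduct.mk F A N 1)) := by
  refine Cocycle.ext F fun a n => ?_
  change ψ (a ⊗ₜ n - 1 ⊗ₜ (a • n)) = a • ψ (1 ⊗ₜ n) - ψ (1 ⊗ₜ (a • n))
  rw [map_sub, ← map_smul, TensorProduct.smul_tmul', smul_eq_mul, mul_one]

theorem exists_cocycleOf_restrict_eq_inner (f : N →ₗ[F] M) :
    ∃ ψ : A ⊗[F] N →ₗ[A] M,
      cocycleOf F (ψ.comp (Syz F A N).subtype) = innerCocycle F A f := by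
  -- This ψ is a ⊗ n ↦ a • f n, the linear extension of `f`.
  refine ⟨(cover F A M).comp (TensorProduct.AlgebraTensorModule.lTensor A A f), ?_⟩
  rw [cocycleOf_restrict]
  congr 1
  ext n
  simp [cover]

end Cocycles

/-! ### Functoriality of derivations in both modules -/

section CocycleFunctoriality

variable (F : Type u) [Field F] {A : Type u} [Ring A] [Algebra F A]
variable {N N' M M' : Type u}
  [AddCommGroup N] [Module F N] [Module A N] [IsScalarTower F A N]
  [AddCommGroup N'] [Module F N'] [Module A N'] [IsScalarTower F A N']
  [AddCommGroup M] [Module F M] [Module A M] [IsScalarTower F A M]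
  [AddCommGroup M'] [Module F M'] [Module A M'] [IsScalarTower F A M']

/-- Composition of a derivation with a map of modules `M → M'`. -/
def Cocycle.push (f : M →ₗ[A] M') : Cocycle F A N M →ₗ[F] Cocycle F A N M' where
  toFun δ := ⟨LinearMap.compr₂ δ.1 (f.restrictScalars F), fun a b n => by
    change f (δ.1 (a * b) n) = a • f (δ.1 b n) + f (δ.1 a (b • n))
    rw [Cocycle.map_mul F δ, map_add, map_smul]⟩
  map_add' δ ε := Cocycle.ext F fun a n => map_add f _ _
  map_smul' c δ := Cocycle.ext F fun a n => f.map_smul_of_tower c _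

/-- Composition of a derivation with a map of modules `N → N'`. -/
def Cocycle.pull (f : N →ₗ[A] N') : Cocycle F A N' M →ₗ[F] Cocycle F A N M where
  toFun δ := ⟨LinearMap.compl₂ δ.1 (f.restrictScalars F), fun a b n => by
    change δ.1 (a * b) (f n) = a • δ.1 b (f n) + δ.1 a (f (b • n))
    rw [Cocycle.map_mul F δ, map_smul f]⟩
  map_add' δ ε := rfl
  map_smul' c δ := rfl

theorem Cocycle.push_cocycleOf (f : M →ₗ[A] M') (u : Syz F A N →ₗ[A] M) :
    Cocycle.push F f (cocycleOf F u) = cocycleOf F (f.comp u) := rfl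

theorem Cocycle.pull_cocycleOf (f : N →ₗ[A] N') (u : Syz F A N' →ₗ[A] M) :
    Cocycle.pull F f (cocycleOf F u) = cocycleOf F (u.comp (Syz.map F f)) := by
  refine Cocycle.ext F fun a n => congrArg u (Subtype.ext ?_)
  rw [Syz.map_coe]
  simp [syzGen]

theorem Cocycle.push_inner (f : M →ₗ[A] M') (g : N →ₗ[F] M) :
    Cocycle.push F f (innerCocycle F A g) = innerCocycle F A ((f.restrictScalars F).comp g) := by
  refine Cocycle.ext F fun a n => ?_
  change f (a • g n - g (a • n)) = a • f (g n) - f (g (a • n))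
  rw [map_sub, map_smul]

theorem Cocycle.pull_inner (f : N →ₗ[A] N') (g : N' →ₗ[F] M) :
    Cocycle.pull F f (innerCocycle F A g) = innerCocycle F A (g.comp (f.restrictScalars F)) := by
  refine Cocycle.ext F fun a n => ?_
  change a • g (f n) - g (a • f n) = a • g (f n) - g (f (a • n))
  rw [map_smul f]

end CocycleFunctoriality

/-! ### Functionals on Hom(P, M) as balanced pairings -/

section RankOneMaps

variable (F : Type u) [Field F] {A : Type u} [Ring A] [Algebra F A]
variable {P M M' W : Type u} [AddCommMonoid P] [Module A P]
  [AddCommGroup M] [Module F M] [Module A M] [IsScalarTower F A M]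
  [AddCommGroup M'] [Module A M']
  [AddCommGroup W] [Module A W] (κ : W ≃ₗ[A] A)

/-- For `φ : P → W` and a trivialization `κ` of `W`, the map `p ↦ κ (φ p) • m`. -/
def rankOneMap (φ : P →ₗ[A] W) (m : M) : P →ₗ[A] M :=
  (LinearMap.toSpanSingleton A M m).comp (κ.toLinearMap.comp φ)

theorem rankOneMap_apply (φ : P →ₗ[A] W) (m : M) (p : P) :
    rankOneMap κ φ m p = κ (φ p) • m := rfl

theorem comp_rankOneMap (φ : P →ₗ[A] W) (m : M) (f : M →ₗ[A] M') :
    f.comp (rankOneMap κ φ m) = rankOneMap κ φ (f m) :=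
  LinearMap.ext fun _ => map_smul f _ m

theorem rankOneMap_add_left (φ ψ : P →ₗ[A] W) (m : M) :
    rankOneMap κ (φ + ψ) m = rankOneMap κ φ m + rankOneMap κ ψ m :=
  LinearMap.ext fun p => by simp [rankOneMap_apply, add_smul]

theorem rankOneMap_add_right (φ : P →ₗ[A] W) (m n : M) :
    rankOneMap κ φ (m + n) = rankOneMap κ φ m + rankOneMap κ φ n :=
  LinearMap.ext fun _ => smul_add _ m n

theorem rankOneMap_smul_right (c : F) (φ : P →ₗ[A] W) (m : M) :
    rankOneMap κ φ (c • m) = c • rankOneMap κ φ m :=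
  LinearMap.ext fun _ => smul_comm _ c m

theorem exists_dual_basis_of_trivialization (P : Type u) [AddCommGroup P] [Module A P]
    [Module.Finite A P] [Module.Projective A P] :
    ∃ (n : ℕ) (c : Fin n → (P →ₗ[A] W)) (b : Fin n → P), ∀ x, ∑ k, κ (c k x) • b k = x := by
  obtain ⟨n, c, b, h⟩ := exists_dual_basis (A := A) (FGModuleCat.of A P)
  exact ⟨n, fun k => κ.symm.toLinearMap.comp (c k), b, fun x => by simpa using h x⟩

theorem eq_sum_rankOneMap {n : ℕ} {c : Fin n → (P →ₗ[A] W)} {b : Fin n → P}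
    (hb : ∀ x, ∑ k, κ (c k x) • b k = x) (u : P →ₗ[A] M) :
    u = ∑ k, rankOneMap κ (c k) (u (b k)) := by
  refine LinearMap.ext fun x => ?_
  conv_lhs => rw [← hb x, map_sum]
  simp [rankOneMap_apply]

theorem eq_on_hom_of_eq_on_rankOneMap {P : Type u} [AddCommGroup P] [Module A P] [Module.Finite A P] [Module.Projective A P]
    {G : Type*} [AddCommGroup G] {θ θ' : (P →ₗ[A] M) →+ G}
    (h : ∀ φ m, θ (rankOneMap κ φ m) = θ' (rankOneMap κ φ m)) : θ = θ' := by
  obtain ⟨n, c, b, hb⟩ := exists_dual_basis_of_trivialization κ P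
  refine AddMonoidHom.ext fun u => ?_
  rw [eq_sum_rankOneMap κ hb u, map_sum, map_sum]
  exact Finset.sum_congr rfl fun k _ => h _ _

/-- This is Hom(P, M) ≅ Hom(P, A) ⊗_A M for `P` finitely generated projective, seen through
functionals; `hβ` says that `β` is balanced over `A`. The trivialization `κ` lets one argument serve
both for `A` as a left module over itself and for `A` as a left module over `Aᵐᵒᵖ`. -/
theorem exists_functional_of_balanced {P : Type u} [AddCommGroup P] [Module A P] [Module.Finite A P] [Module.Projective A P]
    (β : (P →ₗ[A] W) →+ Module.Dual F M)
    (hβ : ∀ (a : A) (m : M) (φ φ' : P →ₗ[A] W), (∀ p, κ (φ' p) = κ (φ p) * a) →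
      β φ' m = β φ (a • m)) :
    ∃ θ : Module.Dual F (P →ₗ[A] M), ∀ φ m, θ (rankOneMap κ φ m) = β φ m := by
  obtain ⟨n, c, b, hb⟩ := exists_dual_basis_of_trivialization κ P
  refine ⟨{ toFun := fun u => ∑ k, β (c k) (u (b k))
            map_add' := fun u v => by simp [Finset.sum_add_distrib]
            map_smul' := fun r u => by simp [Finset.mul_sum] }, fun φ m => ?_⟩
  change ∑ k, β (c k) (κ (φ (b k)) • m) = _
  -- Balancing moves the scalar φ(b_k) onto c_k, and the sum of the c_k φ(b_k) is φ by the dual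
  -- basis identity.
  have h : ∀ k, β (c k) (κ (φ (b k)) • m) =
      β (κ.symm.toLinearMap.comp (rankOneMap κ (c k) (κ (φ (b k))))) m := fun k =>
    (hβ _ _ _ _ fun p => by simp [rankOneMap_apply]).symm
  rw [Finset.sum_congr rfl fun k _ => h k, ← LinearMap.sum_apply, ← map_sum]
  congr 2
  refine LinearMap.ext fun x => κ.injective ?_
  rw [LinearMap.sum_apply, map_sum]
  conv_rhs => rw [← hb x, map_sum, map_sum]
  simp [rankOneMap_apply]

end RankOneMaps

/-! ### The dual of `Ext¹` -/

section Functionals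

variable (F : Type u) [Field F] (A : Type u) [Ring A] [Algebra F A]
variable (N M : Type u) [AddCommGroup N] [Module F N] [Module A N] [IsScalarTower F A N]
  [AddCommGroup M] [Module F M] [Module A M] [IsScalarTower F A M]

/-- The dual of `Ext¹_A (N, M)`: the functionals on derivations killing inner derivations. -/
def ExtDual : Type u := {θ : Module.Dual F (Cocycle F A N M) // ∀ f, θ (innerCocycle F A f) = 0}

variable {A N M} {W : Type u} [AddCommGroup W] [Module A W] (κ : W ≃ₗ[A] A)

theorem ExtDual.apply_restrict (θ : ExtDual F A N M) (ψ : A ⊗[F] N →ₗ[A] M) :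
    θ.1 (cocycleOf F (ψ.comp (Syz F A N).subtype)) = 0 := by
  rw [cocycleOf_restrict, θ.2]

variable [Module.Finite F A] [Module.Finite F N] [Module.Projective A (Syz F A N)]

theorem ExtDual.ext_rankOneMap {θ θ' : ExtDual F A N M}
    (h : ∀ φ m, θ.1 (cocycleOf F (rankOneMap κ φ m)) = θ'.1 (cocycleOf F (rankOneMap κ φ m))) :
    θ = θ' := by
  have := finite_syz F (A := A) N
  have : Module.Finite A (Syz F A N) := Module.Finite.of_restrictScalars_finite F A _
  refine Subtype.ext (LinearMap.ext fun δ => ?_)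
  obtain ⟨u, rfl⟩ := (cocycleOf_bijective F).2 δ
  exact DFunLike.congr_fun (eq_on_hom_of_eq_on_rankOneMap κ (P := Syz F A N)
    (θ := (θ.1.comp (cocycleOf F)).toAddMonoidHom)
    (θ' := (θ'.1.comp (cocycleOf F)).toAddMonoidHom) h) u

/-- An inner derivation comes from some ψ on the free cover. That cover is itself finitely generated
projective, so ψ is a sum of rank-one maps, and `hβ'` kills the restriction of each summand. -/
theorem ExtDual.exists_of_balanced (β : (Syz F A N →ₗ[A] W) →+ Module.Dual F M)
    (hβ : ∀ (a : A) (m : M) (φ φ' : Syz F A N →ₗ[A] W), (∀ p, κ (φ' p) = κ (φ p) * a) →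
      β φ' m = β φ (a • m))
    (hβ' : ∀ ψ : A ⊗[F] N →ₗ[A] W, β (ψ.comp (Syz F A N).subtype) = 0) :
    ∃ θ : ExtDual F A N M, ∀ φ m, θ.1 (cocycleOf F (rankOneMap κ φ m)) = β φ m := by
  have := finite_syz F (A := A) N
  have : Module.Finite A (Syz F A N) := Module.Finite.of_restrictScalars_finite F A _
  obtain ⟨θ, hθ⟩ := exists_functional_of_balanced F κ (P := Syz F A N) β hβ
  let e := LinearEquiv.ofBijective (cocycleOf F) (cocycleOf_bijective F (A := A) (N := N) (M := M))
  have he : ∀ u, e.symm (cocycleOf F u) = u := e.symm_apply_apply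
  refine ⟨⟨θ.comp e.symm.toLinearMap, fun f => ?_⟩, fun φ m => ?_⟩
  · obtain ⟨ψ, hψ⟩ := exists_cocycleOf_restrict_eq_inner F (A := A) f
    rw [← hψ]
    change θ (e.symm _) = 0
    rw [he]
    obtain ⟨n, c, b, hb⟩ := exists_dual_basis_of_trivialization κ (A ⊗[F] N)
    rw [eq_sum_rankOneMap κ hb ψ]
    have h : (∑ k, rankOneMap κ (c k) (ψ (b k))).comp (Syz F A N).subtype =
        ∑ k, rankOneMap κ ((c k).comp (Syz F A N).subtype) (ψ (b k)) :=
      LinearMap.ext fun x => by simp [rankOneMap_apply]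
    rw [h, map_sum]
    refine Finset.sum_eq_zero fun k _ => ?_
    rw [hθ, hβ']
    rfl
  · change θ (e.symm _) = _
    rw [he, hθ]

end Functionals

/-! ### Transposing derivations: Ext¹(N, M) and Ext¹(M^*, N^*) -/

section Transposition

variable (F : Type u) [Field F] {A : Type u} [Ring A] [Algebra F A]
variable {N M : Type u} [AddCommGroup N] [Module F N] [AddCommGroup M] [Module F M]

/-- The map `N → M` with a given transpose `M^* → N^*`. -/
def untranspose [Module.Finite F M] (g : DualL F M →ₗ[F] DualL F N) : N →ₗ[F] M :=
  (Module.evalEquiv F M).symm.toLinearMap.comp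
    (LinearMap.flip (show Module.Dual F M →ₗ[F] Module.Dual F N from g))

theorem apply_untranspose [Module.Finite F M] (g : DualL F M →ₗ[F] DualL F N) (ξ : DualL F M)
    (n : N) : ξ (untranspose F g n) = g ξ n :=
  Module.apply_evalEquiv_symm_apply F M ξ _

theorem DualL.separating {x y : M} (h : ∀ ξ : DualL F M, ξ x = ξ y) : x = y := by
  refine sub_eq_zero.1 ((Module.forall_dual_apply_eq_zero_iff F (x - y)).1 fun ξ => ?_)
  rw [map_sub, sub_eq_zero]
  exact h ξ

variable [Module A N] [IsScalarTower F A N] [Module A M] [IsScalarTower F A M]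

/-- The transposition of derivations. -/
def Cocycle.transpose : Cocycle F A N M →ₗ[F] Cocycle F Aᵐᵒᵖ (DualL F M) (DualL F N) where
  toFun δ := ⟨LinearMap.mk₂ F (fun (b : Aᵐᵒᵖ) (ξ : DualL F M) =>
      (LinearMap.comp (show M →ₗ[F] F from ξ) (δ.1 b.unop) : DualL F N))
      (fun b c ξ => DualL.ext F fun n => by
        change ξ (δ.1 (b.unop + c.unop) n) = ξ (δ.1 b.unop n) + ξ (δ.1 c.unop n)
        rw [map_add, LinearMap.add_apply, map_add])
      (fun r b ξ => DualL.ext F fun n => by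
        change ξ (δ.1 (r • b.unop) n) = r • ξ (δ.1 b.unop n)
        rw [map_smul, LinearMap.smul_apply, map_smul])
      (fun b ξ η => rfl) (fun r b ξ => rfl),
    fun b c ξ => DualL.ext F fun n => by
      change ξ (δ.1 (c.unop * b.unop) n) = ξ (δ.1 c.unop (b.unop • n)) +
        ξ (c.unop • δ.1 b.unop n)
      rw [Cocycle.map_mul F δ, map_add, add_comm]⟩
  map_add' δ ε := Cocycle.ext F fun b ξ => DualL.ext F fun n => map_add ξ _ _
  map_smul' r δ := Cocycle.ext F fun b ξ => DualL.ext F fun n => map_smul ξ r _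

/-- Since `M` is finite-dimensional every map M^* → N^* is a transpose, and the Leibniz rule can be
checked after applying functionals on `M`. -/
theorem Cocycle.transpose_bijective [Module.Finite F M] : Function.Bijective
    (Cocycle.transpose F : Cocycle F A N M →ₗ[F] Cocycle F Aᵐᵒᵖ (DualL F M) (DualL F N)) := by
  constructor
  · intro δ ε h
    refine Cocycle.ext F fun a n => DualL.separating F fun ξ => ?_
    exact DFunLike.congr_fun (congrArg (fun ζ => ζ.1 (MulOpposite.op a) ξ) h) n
  · intro ε
    refine ⟨⟨LinearMap.mk₂ F (fun a n => untranspose F (ε.1 (MulOpposite.op a)) n)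
      (fun a b n => DualL.separating F fun ξ => ?_) (fun r a n => DualL.separating F fun ξ => ?_)
      (fun a n p => map_add _ n p) (fun r a n => map_smul _ r n),
      fun a b n => DualL.separating F fun ξ => ?_⟩,
      Cocycle.ext F fun b ξ => DualL.ext F fun n => ?_⟩
    · rw [map_add, apply_untranspose, apply_untranspose, apply_untranspose, MulOpposite.op_add,
        map_add]
      rfl
    · rw [map_smul, apply_untranspose, apply_untranspose, MulOpposite.op_smul, map_smul]
      rfl
    · simp only [LinearMap.mk₂_apply]
      rw [map_add, apply_untranspose, apply_untranspose, ← DualL.smul_apply, apply_untranspose,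
        MulOpposite.op_mul, Cocycle.map_mul F ε, add_comm]
      rfl
    · exact apply_untranspose F _ ξ n

/-- The sign appears because transposition exchanges the left and right actions, hence the two terms
of the commutator. -/
theorem Cocycle.transpose_inner (f : N →ₗ[F] M) (g : DualL F M →ₗ[F] DualL F N)
    (h : ∀ ξ n, g ξ n = ξ (f n)) :
    Cocycle.transpose F (innerCocycle F A f) = innerCocycle F Aᵐᵒᵖ (-g) := by
  refine Cocycle.ext F fun b ξ => DualL.ext F fun n => ?_
  change ξ (b.unop • f n - f (b.unop • n)) = - g ξ (b.unop • n) - - g (b • ξ) n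
  rw [h, h, map_sub]
  change _ = - ξ (f (b.unop • n)) - - ξ (b.unop • f n)
  ring

/-- The duals of `Ext¹_A (N, M)` and of `Ext¹ (M^*, N^*)` are isomorphic. -/
def ExtDual.transposeEquiv [Module.Finite F M] :
    ExtDual F A N M ≃ ExtDual F Aᵐᵒᵖ (DualL F M) (DualL F N) where
  toFun θ := ⟨θ.1.comp (LinearEquiv.ofBijective _
      (Cocycle.transpose_bijective F)).symm.toLinearMap, fun g => by
    have h := Cocycle.transpose_inner F (A := A) (untranspose F (-g)) (-g)
      fun ξ n => (apply_untranspose F _ ξ n).symm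
    rw [neg_neg] at h
    rw [← h, LinearMap.comp_apply]
    refine (congrArg θ.1 ((LinearEquiv.ofBijective _
      (Cocycle.transpose_bijective F)).symm_apply_apply _)).trans (θ.2 _)⟩
  invFun θ := ⟨θ.1.comp (Cocycle.transpose F), fun f => by
    rw [LinearMap.comp_apply, Cocycle.transpose_inner F f
      ((LinearMap.lcomp F F f : (M →ₗ[F] F) →ₗ[F] (N →ₗ[F] F))) fun ξ n => rfl, θ.2]⟩
  left_inv θ := Subtype.ext (LinearMap.ext fun δ => congrArg θ.1 ((LinearEquiv.ofBijective _
      (Cocycle.transpose_bijective F)).symm_apply_apply δ))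
  right_inv θ := Subtype.ext (LinearMap.ext fun δ => congrArg θ.1 ((LinearEquiv.ofBijective _
      (Cocycle.transpose_bijective F)).apply_symm_apply δ))

end Transposition

/-! ### Projectivity of syzygies of left and right modules -/

section ProjectiveSyzygies

variable (F : Type u) [Field F] {A : Type u} [Ring A] [Algebra F A]

theorem cover_surjective (M : Type u) [AddCommGroup M] [Module F M] [Module A M]
    [IsScalarTower F A M] : Function.Surjective (cover F A M) :=
  fun m => ⟨1 ⊗ₜ m, by simp [cover]⟩

theorem projective_syz (hA : IsHereditary A) (M : Type u) [AddCommGroup M] [Module F M]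
    [Module A M] [IsScalarTower F A M] : Module.Projective A (Syz F A M) :=
  hA (A ⊗[F] M) inferInstance _

variable {X Y : Type u} [AddCommGroup X] [Module F X] [Module A X] [IsScalarTower F A X]
  [AddCommGroup Y] [Module F Y] [Module Aᵐᵒᵖ Y] [IsScalarTower F Aᵐᵒᵖ Y]

/-- The adjunct `Y → X^*` of a map `X → Y^*`. -/
def flipDualR (f : X →ₗ[A] DualR F Y) : Y →ₗ[Aᵐᵒᵖ] DualL F X where
  toFun y :=
    { toFun := fun x => f x y
      map_add' := fun x x' => by rw [map_add]; rfl
      map_smul' := fun c x => by rw [LinearMap.map_smul_of_tower]; rfl }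
  map_add' y y' := DualL.ext F fun x => map_add (f x) y y'
  map_smul' a y := DualL.ext F fun x => by
    change f x (a • y) = f (a.unop • x) y
    rw [map_smul f]
    rfl

/-- The adjunct `X → Y^*` of a map `Y → X^*`. -/
def flipDualL (f : Y →ₗ[Aᵐᵒᵖ] DualL F X) : X →ₗ[A] DualR F Y where
  toFun x :=
    { toFun := fun y => f y x
      map_add' := fun y y' => by rw [map_add]; rfl
      map_smul' := fun c y => by rw [LinearMap.map_smul_of_tower]; rfl }
  map_add' x x' := DualR.ext F fun y => map_add (f y) x x'
  map_smul' a x := DualR.ext F fun y => by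
    change f y (a • x) = f (MulOpposite.op a • y) x
    rw [map_smul f]
    rfl

theorem DualL.map_surjective {X' : Type u} [AddCommGroup X'] [Module F X'] [Module A X']
    [IsScalarTower F A X'] {i : X →ₗ[A] X'} (hi : Function.Injective i) :
    Function.Surjective (DualL.map F i) := fun ξ => by
  obtain ⟨η, hη⟩ := LinearMap.exists_leftInverse_of_injective (i.restrictScalars F)
    (LinearMap.ker_eq_bot.2 hi)
  exact ⟨(LinearMap.comp (show X →ₗ[F] F from ξ) η : X' →ₗ[F] F),
    DualL.ext F fun x => congrArg ξ (LinearMap.congr_fun hη x)⟩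

theorem DualR.map_surjective {Y' : Type u} [AddCommGroup Y'] [Module F Y'] [Module Aᵐᵒᵖ Y']
    [IsScalarTower F Aᵐᵒᵖ Y'] {i : Y →ₗ[Aᵐᵒᵖ] Y'} (hi : Function.Injective i) :
    Function.Surjective (DualR.map F i) := fun ξ => by
  obtain ⟨η, hη⟩ := LinearMap.exists_leftInverse_of_injective (i.restrictScalars F)
    (LinearMap.ker_eq_bot.2 hi)
  exact ⟨(LinearMap.comp (show Y →ₗ[F] F from ξ) η : Y' →ₗ[F] F),
    DualR.ext F fun x => congrArg ξ (LinearMap.congr_fun hη x)⟩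

/-- Under the correspondence of maps X → Y^* with maps Y → X^*, extending from an ideal I to `A`
becomes lifting along the surjection A^* → I^*. -/
theorem injective_dualR [Module.Projective Aᵐᵒᵖ Y] : Module.Injective A (DualR F Y) := by
  refine Module.Baer.injective fun I g => ?_
  obtain ⟨k, hk⟩ := Module.projective_lifting_property (DualL.map F I.subtype) (flipDualR F g)
    (DualL.map_surjective F I.subtype_injective)
  refine ⟨flipDualL F k, fun x hx => DualR.ext F fun y => ?_⟩
  exact DFunLike.congr_fun (LinearMap.congr_fun hk y) (⟨x, hx⟩ : I)

omit [Algebra F A] in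
-- A left ideal is projective, so a map from it to `Q'` lifts to `Q`; there it extends to `A`, and
-- `π` brings the extension back.
theorem IsHereditary.injective_of_surjective (hA : IsHereditary A) {Q Q' : Type u}
    [AddCommGroup Q] [Module A Q] [AddCommGroup Q'] [Module A Q'] [Module.Injective A Q]
    (π : Q →ₗ[A] Q') (hπ : Function.Surjective π) : Module.Injective A Q' := by
  refine Module.Baer.injective fun I g => ?_
  have : Module.Projective A I := hA A inferInstance I
  obtain ⟨k, hk⟩ := Module.projective_lifting_property π g hπ
  obtain ⟨k', hk'⟩ := Module.Baer.of_injective (R := A) (Q := Q) ‹_› I k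
  exact ⟨π.comp k', fun x hx => by
    rw [LinearMap.comp_apply, hk', ← LinearMap.comp_apply, hk]⟩

/-- The dual of the free cover of `Y` is a monomorphism out of an injective module, so it has a
retraction; the transpose of the retraction splits the cover. -/
theorem projective_of_injective_dualR [Module.Finite F A] [Module.Finite F Y]
    [Module.Injective A (DualR F Y)] : Module.Projective Aᵐᵒᵖ Y := by
  have hs := cover_surjective F (A := Aᵐᵒᵖ) Y
  have hi : Function.Injective (DualR.map F (cover F Aᵐᵒᵖ Y)) := fun ξ η h =>
    DualR.ext F fun y => by
      obtain ⟨z, rfl⟩ := hs y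
      exact DFunLike.congr_fun h z
  obtain ⟨r, hr⟩ := Module.Injective.out (R := A) (DualR.map F (cover F Aᵐᵒᵖ Y)) hi LinearMap.id
  let E := Module.evalEquiv F (Aᵐᵒᵖ ⊗[F] Y)
  let s₀ : Y →ₗ[F] Aᵐᵒᵖ ⊗[F] Y := E.symm.toLinearMap.comp
    (LinearMap.flip (r.restrictScalars F : DualR F (Aᵐᵒᵖ ⊗[F] Y) →ₗ[F] DualR F Y))
  have hs₀ : ∀ (ξ : DualR F (Aᵐᵒᵖ ⊗[F] Y)) (y : Y), ξ (s₀ y) = r ξ y := fun ξ y =>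
    Module.apply_evalEquiv_symm_apply F (Aᵐᵒᵖ ⊗[F] Y) ξ _
  let s : Y →ₗ[Aᵐᵒᵖ] Aᵐᵒᵖ ⊗[F] Y :=
    { toFun := s₀
      map_add' := map_add s₀
      map_smul' := fun a y => DualL.separating F fun ξ => by
        -- `a.unop • ξ` is ξ composed with the right action of `a`, so linearity of `r` over `A`
        -- transposes to linearity of `s₀` over `Aᵐᵒᵖ`.
        have h := hs₀ (a.unop • (id ξ : DualR F (Aᵐᵒᵖ ⊗[F] Y))) y
        rw [map_smul] at h
        exact (hs₀ ξ (a • y)).trans h.symm }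
  refine Module.Projective.of_split s (cover F Aᵐᵒᵖ Y) (LinearMap.ext fun y =>
    DualL.separating F fun η => ?_)
  exact (hs₀ (DualR.map F (cover F Aᵐᵒᵖ Y) η) y).trans (DFunLike.congr_fun (hr η) y)

/-- Heredity is assumed on the left only. The dual of a right syzygy is a quotient of the injective
left module (A ⊗ Y)^*, hence injective, and finite dimension lets projectivity be read off from the
dual. -/
theorem projective_syz_op [Module.Finite F A] (hA : IsHereditary A) (Y : Type u) [AddCommGroup Y]
    [Module F Y] [Module Aᵐᵒᵖ Y] [IsScalarTower F Aᵐᵒᵖ Y] [Module.Finite F Y] :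
    Module.Projective Aᵐᵒᵖ (Syz F Aᵐᵒᵖ Y) := by
  have := finite_syz F (A := Aᵐᵒᵖ) Y
  have : Module.Injective A (DualR F (Aᵐᵒᵖ ⊗[F] Y)) := injective_dualR F
  have : Module.Injective A (DualR F (Syz F Aᵐᵒᵖ Y)) := hA.injective_of_surjective
    (DualR.map F (Syz F Aᵐᵒᵖ Y).subtype)
    (DualR.map_surjective F (Submodule.subtype_injective _))
  exact projective_of_injective_dualR F (Y := Syz F Aᵐᵒᵖ Y)

end ProjectiveSyzygies

/-! ### Pairings defined by functionals on `Ext¹`, and their naturality -/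

section ExtPairing

variable (F : Type u) [Field F] {A : Type u} [Ring A] [Algebra F A]
variable {N M : Type u} [AddCommGroup N] [Module F N] [Module A N] [IsScalarTower F A N]
  [AddCommGroup M] [Module F M] [Module A M] [IsScalarTower F A M]

section Lift

variable {B : Type u} [Ring B] [Algebra F B] {W : Type u} [AddCommGroup W] [Module F W]
  [Module A W] [Module B W] [SMulCommClass A B W] [IsScalarTower F A W] [IsScalarTower F B W]

/-- The map on `Ext¹` induced by a map on `Hom (Syz N, W)` which kills restrictions. -/
def ExtOne.lift {G : Type u} [AddCommGroup G] [Module F G] (f : (Syz F A N →ₗ[A] W) →ₗ[F] G)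
    (hf : ∀ ψ : A ⊗[F] N →ₗ[A] W, f (ψ.comp (Syz F A N).subtype) = 0) :
    ExtOne F A B N W →ₗ[F] G :=
  (Submodule.liftQ ((LinearMap.range (precomp B (W := W) (Syz F A N).subtype)).restrictScalars F)
    f (by rintro _ ⟨ψ, rfl⟩; exact hf ψ)).comp
    (Submodule.Quotient.restrictScalarsEquiv F
      (LinearMap.range (precomp B (W := W) (Syz F A N).subtype))).symm.toLinearMap

set_option linter.unusedSectionVars false in
theorem ExtOne.mk_restrict (ψ : A ⊗[F] N →ₗ[A] W) :
    (Submodule.Quotient.mk (ψ.comp (Syz F A N).subtype) : ExtOne F A B N W) = 0 :=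
  (Submodule.Quotient.mk_eq_zero _).2 ⟨ψ, rfl⟩

/-- The pairing of `Hom (Syz N, W)` with `M` defined by a functional on `Ext¹ (N, M)`. -/
def ExtDual.pairing (κ : W ≃ₗ[A] A) (θ : ExtDual F A N M) :
    (Syz F A N →ₗ[A] W) →ₗ[F] M →ₗ[F] F :=
  LinearMap.mk₂ F (fun φ m => θ.1 (cocycleOf F (rankOneMap κ φ m)))
    (fun φ ψ m => by rw [rankOneMap_add_left, map_add, map_add])
    (fun c φ m => by
      have h : rankOneMap κ (c • φ) m = c • rankOneMap κ φ m := LinearMap.ext fun p => by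
        have := κ.toLinearMap.map_smul_of_tower c (φ p)
        simp only [LinearEquiv.coe_coe] at this
        simp [rankOneMap_apply, this, smul_assoc]
      rw [h, map_smul, map_smul])
    (fun φ m n => by rw [rankOneMap_add_right, map_add, map_add])
    (fun c φ m => by rw [rankOneMap_smul_right, map_smul, map_smul])

theorem ExtDual.pairing_restrict (κ : W ≃ₗ[A] A) (θ : ExtDual F A N M)
    (ψ : A ⊗[F] N →ₗ[A] W) : θ.pairing F κ (ψ.comp (Syz F A N).subtype) = 0 :=
  LinearMap.ext fun m => θ.apply_restrict F (rankOneMap κ ψ m)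

end Lift

section Naturality

variable {N' M' : Type u} [AddCommGroup N'] [Module F N'] [Module A N'] [IsScalarTower F A N']
  [AddCommGroup M'] [Module F M'] [Module A M'] [IsScalarTower F A M']

/-- Covariance of the dual of `Ext¹ (N, M)` in `N`. -/
def ExtDual.mapLeft (f : N →ₗ[A] N') (θ : ExtDual F A N M) : ExtDual F A N' M :=
  ⟨θ.1.comp (Cocycle.pull F f), fun g => by
    rw [LinearMap.comp_apply, Cocycle.pull_inner, θ.2]⟩

/-- Contravariance of the dual of `Ext¹ (N, M)` in `M`. -/
def ExtDual.mapRight (f : M' →ₗ[A] M) (θ : ExtDual F A N M) : ExtDual F A N M' :=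
  ⟨θ.1.comp (Cocycle.push F f), fun g => by
    rw [LinearMap.comp_apply, Cocycle.push_inner, θ.2]⟩

/-- The inverse of `ExtDual.transposeEquiv` is composition with `Cocycle.transpose`, so in this
direction both sides unfold to the same functional. -/
theorem ExtDual.transposeEquiv_symm_mapLeft [Module.Finite F M] [Module.Finite F M']
    (f : M' →ₗ[A] M) (θ : ExtDual F Aᵐᵒᵖ (DualL F M) (DualL F N)) :
    (ExtDual.transposeEquiv F).symm (θ.mapLeft F (DualL.map F f)) =
      ((ExtDual.transposeEquiv F).symm θ).mapRight F f := rfl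

theorem ExtDual.transposeEquiv_symm_mapRight [Module.Finite F M]
    (f : N →ₗ[A] N') (θ : ExtDual F Aᵐᵒᵖ (DualL F M) (DualL F N)) :
    (ExtDual.transposeEquiv F).symm (θ.mapRight F (DualL.map F f)) =
      ((ExtDual.transposeEquiv F).symm θ).mapLeft F f := rfl

end Naturality

end ExtPairing

/-! ### Ext¹(N, M)^* as Hom(M, τN) -/

section HomTau

variable (F : Type u) [Field F] {A : Type u} [Ring A] [Algebra F A]
variable {N M : Type u} [AddCommGroup N] [Module F N] [Module A N] [IsScalarTower F A N]
  [AddCommGroup M] [Module F M] [Module A M] [IsScalarTower F A M]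

/-- The map `M → τ N` defined by a functional on `Ext¹ (N, M)`. -/
def ExtDual.toHomTau (θ : ExtDual F A N M) : M →ₗ[A] DualR F (ExtOne F A Aᵐᵒᵖ N A) where
  toFun m := ExtOne.lift F ((θ.pairing F (LinearEquiv.refl A A)).flip m) fun ψ => by
    rw [LinearMap.flip_apply, θ.pairing_restrict]; rfl
  map_add' m n := DualR.ext F fun x => by
    obtain ⟨φ, rfl⟩ := Submodule.Quotient.mk_surjective _ x
    exact map_add (θ.pairing F (LinearEquiv.refl A A) φ) m n
  map_smul' a m := DualR.ext F fun x => by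
    obtain ⟨φ, rfl⟩ := Submodule.Quotient.mk_surjective _ x
    refine congrArg (fun u => θ.1 (cocycleOf F u)) (LinearMap.ext fun p => ?_)
    exact (mul_smul (φ p) a m).symm

theorem ExtDual.toHomTau_apply_mk (θ : ExtDual F A N M) (m : M) (φ : Syz F A N →ₗ[A] A) :
    θ.toHomTau F m (Submodule.Quotient.mk φ) =
      θ.1 (cocycleOf F (rankOneMap (LinearEquiv.refl A A) φ m)) := rfl

/-- Injectivity holds because rank-one maps span. For surjectivity, h : M → τN is read as the
pairing (φ, m) ↦ h m [φ]: linearity of h makes it balanced, and it vanishes on restrictions because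
these are zero in `ExtOne`. -/
theorem ExtDual.toHomTau_bijective [Module.Finite F A] [Module.Finite F N]
    [Module.Projective A (Syz F A N)] :
    Function.Bijective (ExtDual.toHomTau F : ExtDual F A N M → _) := by
  constructor
  · intro θ θ' h
    refine ExtDual.ext_rankOneMap F (LinearEquiv.refl A A) fun φ m => ?_
    rw [← θ.toHomTau_apply_mk, h, toHomTau_apply_mk]
  · intro h
    obtain ⟨θ, hθ⟩ := ExtDual.exists_of_balanced F (N := N) (M := M) (LinearEquiv.refl A A)
      { toFun := fun φ =>
          { toFun := fun m => h m (Submodule.Quotient.mk φ)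
            map_add' := fun m n => by rw [map_add]; rfl
            map_smul' := fun c m => by rw [LinearMap.map_smul_of_tower]; rfl }
        map_zero' := LinearMap.ext fun m => map_zero (h m)
        map_add' := fun φ ψ => LinearMap.ext fun m =>
          map_add (h m) (Submodule.Quotient.mk φ) (Submodule.Quotient.mk ψ) }
      (fun a m φ φ' hφ => by
        have e : φ' = MulOpposite.op a • φ := LinearMap.ext hφ
        change h m (Submodule.Quotient.mk φ') = h (a • m) (Submodule.Quotient.mk φ)
        rw [e, map_smul h]
        rfl)
      (fun ψ => LinearMap.ext fun m =>
        (congrArg (h m) (ExtOne.mk_restrict F (B := Aᵐᵒᵖ) ψ)).trans (map_zero (h m)))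
    refine ⟨θ, LinearMap.ext fun m => DualR.ext F fun x => ?_⟩
    obtain ⟨φ, rfl⟩ := Submodule.Quotient.mk_surjective _ x
    exact hθ φ m

variable {N' M' : Type u} [AddCommGroup N'] [Module F N'] [Module A N'] [IsScalarTower F A N']
  [AddCommGroup M'] [Module F M'] [Module A M'] [IsScalarTower F A M']

theorem ExtDual.toHomTau_mapRight (f : M' →ₗ[A] M) (θ : ExtDual F A N M) :
    (θ.mapRight F f).toHomTau F = (θ.toHomTau F).comp f := by
  refine LinearMap.ext fun m => DualR.ext F fun x => ?_
  obtain ⟨φ, rfl⟩ := Submodule.Quotient.mk_surjective _ x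
  refine congrArg θ.1 ((Cocycle.push_cocycleOf F f _).trans (congrArg _ ?_))
  exact comp_rankOneMap _ _ _ _

theorem ExtDual.toHomTau_mapLeft (f : N →ₗ[A] N') (θ : ExtDual F A N M) :
    (θ.mapLeft F f).toHomTau F =
      (DualR.map F (ExtOne.map F Aᵐᵒᵖ A f)).comp (θ.toHomTau F) := by
  refine LinearMap.ext fun m => DualR.ext F fun x => ?_
  obtain ⟨φ, rfl⟩ := Submodule.Quotient.mk_surjective _ x
  exact congrArg θ.1 (Cocycle.pull_cocycleOf F f _)

end HomTau

/-! ### Ext¹(X, N^*)^* as Hom(Ext¹(X, A), N) -/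

section HomTauInv

variable (F : Type u) [Field F] {A : Type u} [Ring A] [Algebra F A]

variable (A) in
/-- The regular right module is free of rank one over the opposite algebra. -/
def opTrivialization : A ≃ₗ[Aᵐᵒᵖ] Aᵐᵒᵖ :=
  { MulOpposite.opAddEquiv with map_smul' := fun _ _ => rfl }

variable {N X : Type u} [AddCommGroup N] [Module F N] [Module A N] [IsScalarTower F A N]
  [AddCommGroup X] [Module F X] [Module Aᵐᵒᵖ X] [IsScalarTower F Aᵐᵒᵖ X]
  [Module.Finite F N]

/-- The `F`-linear map underlying `ExtDual.toHomExt`. -/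
def ExtDual.toHomExtAux (θ : ExtDual F Aᵐᵒᵖ X (DualL F N)) : ExtOne F Aᵐᵒᵖ A X A →ₗ[F] N :=
  ExtOne.lift F ((Module.evalEquiv F N).symm.toLinearMap.comp
    (ExtDual.pairing F (M := DualL F N) (opTrivialization A) θ)) fun ψ =>
    (congrArg (Module.evalEquiv F N).symm (θ.pairing_restrict F (opTrivialization A) ψ)).trans
      (map_zero _)

theorem ExtDual.apply_toHomExtAux_mk (θ : ExtDual F Aᵐᵒᵖ X (DualL F N)) (ξ : DualL F N)
    (ψ : Syz F Aᵐᵒᵖ X →ₗ[Aᵐᵒᵖ] A) : ξ (θ.toHomExtAux F (Submodule.Quotient.mk ψ)) =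
      θ.1 (cocycleOf F (rankOneMap (opTrivialization A) ψ ξ)) :=
  Module.apply_evalEquiv_symm_apply F N ξ _

/-- The map `Ext¹ (X, A) → N` defined by a functional on `Ext¹ (X, N^*)`. -/
def ExtDual.toHomExt (θ : ExtDual F Aᵐᵒᵖ X (DualL F N)) : ExtOne F Aᵐᵒᵖ A X A →ₗ[A] N where
  toFun := θ.toHomExtAux F
  map_add' := map_add _
  map_smul' a x := DualL.separating F fun ξ => by
    obtain ⟨ψ, rfl⟩ := Submodule.Quotient.mk_surjective _ x
    refine (θ.apply_toHomExtAux_mk F ξ (a • ψ)).trans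
      (Eq.trans ?_ (θ.apply_toHomExtAux_mk F (MulOpposite.op a • ξ) ψ).symm)
    refine congrArg (fun u => θ.1 (cocycleOf F u)) (LinearMap.ext fun p => ?_)
    exact mul_smul (MulOpposite.op (ψ p)) (MulOpposite.op a) ξ

theorem ExtDual.apply_toHomExt_mk (θ : ExtDual F Aᵐᵒᵖ X (DualL F N)) (ξ : DualL F N)
    (ψ : Syz F Aᵐᵒᵖ X →ₗ[Aᵐᵒᵖ] A) : ξ (θ.toHomExt F (Submodule.Quotient.mk ψ)) =
      θ.1 (cocycleOf F (rankOneMap (opTrivialization A) ψ ξ)) :=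
  θ.apply_toHomExtAux_mk F ξ ψ

/-- The argument for `toHomTau` over `Aᵐᵒᵖ`, with N recovered from its double dual: a map g gives
the pairing (ψ, ξ) ↦ ξ (g [ψ]). -/
theorem ExtDual.toHomExt_bijective [Module.Finite F A] [Module.Finite F X]
    [Module.Projective Aᵐᵒᵖ (Syz F Aᵐᵒᵖ X)] :
    Function.Bijective (ExtDual.toHomExt F : ExtDual F Aᵐᵒᵖ X (DualL F N) → _) := by
  constructor
  · intro θ θ' h
    refine ExtDual.ext_rankOneMap F (opTrivialization A) fun ψ ξ => ?_
    rw [← θ.apply_toHomExt_mk, h, apply_toHomExt_mk]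
  · intro g
    obtain ⟨θ, hθ⟩ := ExtDual.exists_of_balanced F (A := Aᵐᵒᵖ) (N := X) (M := DualL F N)
      (opTrivialization A)
      { toFun := fun ψ => Module.evalEquiv F N (g (Submodule.Quotient.mk ψ))
        map_zero' := by rw [Submodule.Quotient.mk_zero, map_zero, map_zero]; rfl
        map_add' := fun φ ψ => by rw [Submodule.Quotient.mk_add, map_add, map_add]; rfl }
      (fun a ξ φ φ' hφ => by
        -- Right multiplication in `Aᵐᵒᵖ` is left multiplication in `A`, so the balancing relation
        -- is linearity of `g` for the left action on `ExtOne`.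
        have e : φ' = a.unop • φ := LinearMap.ext fun p => MulOpposite.op_injective (hφ p)
        change ξ (g (Submodule.Quotient.mk φ')) = ξ (a.unop • g (Submodule.Quotient.mk φ))
        rw [e, Submodule.Quotient.mk_smul, map_smul g])
      (fun ψ => LinearMap.ext fun ξ => by
        refine (congrArg (fun x => (show DualL F N from ξ) (g x))
          (ExtOne.mk_restrict F (B := A) ψ)).trans ?_
        exact (congrArg _ (map_zero g)).trans (map_zero ξ))
    refine ⟨θ, LinearMap.ext fun x => DualL.separating F fun ξ => ?_⟩
    obtain ⟨ψ, rfl⟩ := Submodule.Quotient.mk_surjective _ x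
    exact (θ.apply_toHomExt_mk F ξ ψ).trans (hθ ψ ξ)

theorem ExtDual.toHomExt_mapLeft {X' : Type u} [AddCommGroup X'] [Module F X'] [Module Aᵐᵒᵖ X']
    [IsScalarTower F Aᵐᵒᵖ X'] (f : X →ₗ[Aᵐᵒᵖ] X') (θ : ExtDual F Aᵐᵒᵖ X (DualL F N)) :
    (θ.mapLeft F f).toHomExt F = (θ.toHomExt F).comp (ExtOne.map F A A f) := by
  refine LinearMap.ext fun x => DualL.separating F fun ξ => ?_
  obtain ⟨ψ, rfl⟩ := Submodule.Quotient.mk_surjective _ x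
  refine (apply_toHomExt_mk F _ ξ ψ).trans
    (Eq.trans ?_ (θ.apply_toHomExt_mk F ξ (ψ.comp (Syz.map F f))).symm)
  exact congrArg θ.1 (Cocycle.pull_cocycleOf F f _)

theorem ExtDual.toHomExt_mapRight {N' : Type u} [AddCommGroup N'] [Module F N'] [Module A N']
    [IsScalarTower F A N'] [Module.Finite F N'] (f : N →ₗ[A] N')
    (θ : ExtDual F Aᵐᵒᵖ X (DualL F N)) :
    (θ.mapRight F (DualL.map F f)).toHomExt F = f.comp (θ.toHomExt F) := by
  refine LinearMap.ext fun x => DualL.separating F fun ξ => ?_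
  obtain ⟨ψ, rfl⟩ := Submodule.Quotient.mk_surjective _ x
  refine (apply_toHomExt_mk F _ ξ ψ).trans
    (Eq.trans ?_ (θ.apply_toHomExt_mk F (DualL.map F f ξ) ψ).symm)
  refine congrArg θ.1 ((Cocycle.push_cocycleOf F (DualL.map F f) _).trans (congrArg _ ?_))
  exact comp_rankOneMap _ _ _ _

end HomTauInv

/-! ### The adjunction between τ⁻ and τ -/

section TauAdjunction

variable (F : Type u) [Field F] {A : Type u} [Ring A] [Algebra F A] [Module.Finite F A]
  (hA : IsHereditary A)

/-- Functionals on `Ext¹ (N, M)` as maps `M → τ N`. -/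
def extDualEquivHomTau (M N : FGModuleCat.{u} A) :
    ExtDual F A N M ≃ (M ⟶ (tau F A).obj N) :=
  have := projective_syz F hA N
  (Equiv.ofBijective _ (ExtDual.toHomTau_bijective F (N := N) (M := M))).trans
    { toFun := fun h => FGModuleCat.ofHom h
      invFun := fun h => h.hom.hom
      left_inv := fun _ => rfl
      right_inv := fun _ => rfl }

/-- Functionals on `Ext¹ (M^*, N^*)` as maps `τ⁻ M → N`. -/
def extDualEquivTauInvHom (M N : FGModuleCat.{u} A) :
    ExtDual F Aᵐᵒᵖ (DualL F M) (DualL F N) ≃ ((tauInv F A).obj M ⟶ N) :=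
  have := projective_syz_op F hA (DualL F M)
  (Equiv.ofBijective _ (ExtDual.toHomExt_bijective F (N := N) (X := DualL F M))).trans
    { toFun := fun h => FGModuleCat.ofHom h
      invFun := fun h => h.hom.hom
      left_inv := fun _ => rfl
      right_inv := fun _ => rfl }

theorem extDualEquivHomTau_mapRight {M' M N : FGModuleCat.{u} A} (f : M' ⟶ M)
    (θ : ExtDual F A N M) : extDualEquivHomTau F hA M' N (θ.mapRight F f.hom.hom) =
      f ≫ extDualEquivHomTau F hA M N θ :=
  FGModuleCat.hom_ext (ExtDual.toHomTau_mapRight F f.hom.hom θ)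

theorem extDualEquivHomTau_mapLeft {M N N' : FGModuleCat.{u} A} (f : N ⟶ N')
    (θ : ExtDual F A N M) : extDualEquivHomTau F hA M N' (θ.mapLeft F f.hom.hom) =
      extDualEquivHomTau F hA M N θ ≫ (tau F A).map f :=
  FGModuleCat.hom_ext (ExtDual.toHomTau_mapLeft F f.hom.hom θ)

theorem extDualEquivTauInvHom_mapLeft {M' M N : FGModuleCat.{u} A} (f : M' ⟶ M)
    (θ : ExtDual F Aᵐᵒᵖ (DualL F M) (DualL F N)) :
    extDualEquivTauInvHom F hA M' N (θ.mapLeft F (DualL.map F f.hom.hom)) =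
      (tauInv F A).map f ≫ extDualEquivTauInvHom F hA M N θ :=
  FGModuleCat.hom_ext (ExtDual.toHomExt_mapLeft F (DualL.map F f.hom.hom) θ)

theorem extDualEquivTauInvHom_mapRight {M N N' : FGModuleCat.{u} A} (f : N ⟶ N')
    (θ : ExtDual F Aᵐᵒᵖ (DualL F M) (DualL F N)) :
    extDualEquivTauInvHom F hA M N' (θ.mapRight F (DualL.map F f.hom.hom)) =
      extDualEquivTauInvHom F hA M N θ ≫ f :=
  FGModuleCat.hom_ext (ExtDual.toHomExt_mapRight F f.hom.hom θ)

/-- For a hereditary algebra `τ⁻` is left adjoint to `τ`: both `Hom (τ⁻ M, N)` and `Hom (M, τ N)`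
are the dual of `Ext¹ (N, M)`. -/
def tauAdjunction : tauInv F A ⊣ tau F A :=
  Adjunction.mkOfHomEquiv
    { homEquiv := fun M N => (extDualEquivTauInvHom F hA M N).symm.trans
        ((ExtDual.transposeEquiv F).symm.trans (extDualEquivHomTau F hA M N))
      homEquiv_naturality_left_symm := fun {M' M N} f g => by
        -- Writing `g` as the image of a functional θ reduces naturality of the composite bijection
        -- to that of its factors on θ.
        obtain ⟨θ, rfl⟩ := ((ExtDual.transposeEquiv F).symm.trans
          (extDualEquivHomTau F hA M N)).surjective g
        rw [Equiv.symm_apply_eq]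
        simp only [Equiv.trans_apply, Equiv.symm_trans_apply, Equiv.symm_symm,
          Equiv.symm_apply_apply, Equiv.apply_symm_apply]
        rw [← extDualEquivTauInvHom_mapLeft, Equiv.symm_apply_apply,
          ExtDual.transposeEquiv_symm_mapLeft, extDualEquivHomTau_mapRight]
      homEquiv_naturality_right := fun {M N N'} f g => by
        obtain ⟨θ, rfl⟩ := (extDualEquivTauInvHom F hA M N).surjective f
        simp only [Equiv.trans_apply, Equiv.symm_apply_apply]
        rw [← extDualEquivTauInvHom_mapRight, Equiv.symm_apply_apply,
          ExtDual.transposeEquiv_symm_mapRight, extDualEquivHomTau_mapLeft] }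

end TauAdjunction

end

end HereditaryAlgebra

theorem proposition3p3 {F Λ : Type u} [Field F] [Ring Λ] [Algebra F Λ] [Module.Finite F Λ]
    (hΛ : HereditaryAlgebra.IsHereditary Λ) :
    -- the functor `τ⁻` is left adjoint to `τ`
    Nonempty (HereditaryAlgebra.tauInv F Λ ⊣ HereditaryAlgebra.tau F Λ) ∧
    -- and, whichever adjunction is used to define `Δ`, the map `Δ` is
    ∀ adj : HereditaryAlgebra.tauInv F Λ ⊣ HereditaryAlgebra.tau F Λ,
      -- an isomorphism of algebras
      (∃ e : HereditaryAlgebra.Preprojective F Λ ≃ₐ[F] HereditaryAlgebra.Postinjective F Λ,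
        ∀ x, e x = HereditaryAlgebra.Delta F adj x) ∧
      -- which respects the gradings
      (∀ r : ℕ, (HereditaryAlgebra.Preprojective.degree F Λ r).map
          (HereditaryAlgebra.Delta F adj) = HereditaryAlgebra.Postinjective.degree F Λ r) ∧
      -- and is given on each component `Hom (P, τ^{-r} Q)` by the chain of isomorphisms `delta`
      ∀ (P Q : FGModuleCat.{u} Λ) [Module.Projective Λ P] [Module.Projective Λ Q] (r : ℕ)
        (a : HereditaryAlgebra.regular Λ ⟶ P) (b : Q ⟶ HereditaryAlgebra.regular Λ)
        (f : P ⟶ (HereditaryAlgebra.iterL (HereditaryAlgebra.tauInv F Λ) r).obj Q),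
        HereditaryAlgebra.Delta F adj (HereditaryAlgebra.Preprojective.of F Λ r
            (a ≫ f ≫ (HereditaryAlgebra.iterL (HereditaryAlgebra.tauInv F Λ) r).map b)) =
          HereditaryAlgebra.Postinjective.of F Λ r
            ((HereditaryAlgebra.iterR (HereditaryAlgebra.tau F Λ) r).map
                ((HereditaryAlgebra.nuRegular F Λ).inv ≫ (HereditaryAlgebra.nu F Λ).map a) ≫
              HereditaryAlgebra.delta F adj P Q r f ≫
              (HereditaryAlgebra.nu F Λ).map b ≫ (HereditaryAlgebra.nuRegular F Λ).hom) :=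
  ⟨⟨HereditaryAlgebra.tauAdjunction F hΛ⟩, fun adj =>
    ⟨⟨HereditaryAlgebra.DeltaEquiv F adj, fun _ => rfl⟩,
      HereditaryAlgebra.map_degree_Delta F adj,
      fun P Q _ _ r a b f => HereditaryAlgebra.Delta_component F adj P Q r a b f⟩⟩
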